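/- Let $(A,\mathfrak m)$ be a one-dimensional Noetherian Cohen–Macaulay local ring with infinite residue field, let $xA$ be a minimal reduction of $\mathfrak m$, and let $r$ be the least integer with $\mathfrak m^{r+1}=x\mathfrak m^{r}$ (the reduction number). Write $\lambda$ for length and $\mu$ for minimal number of generators. Let $G(\mathfrak m)=\bigoplus_{n\ge 0}\mathfrak m^n/\mathfrak m^{n+1}$ be the tangent cone, let $F(x)=\bigoplus_{n\ge 0}x^nA/x^n\mathfrak m$, acting on $G(\mathfrak m)$ through the natural map $F(x)\to G(\mathfrak m)$, and let $x^*\in F(x)$ be the class of $x$ in degree one. - The invariants of the tangent cone with respect to $x$ are the non-negative integers $\alpha_i$ ($0\le i\le r$) and $\alpha_{i,j}$ ($1\le i\le r-1$, $1\le j\le r-i$) in a decomposition of graded $F(x)$-modules $$G(\mathfrak m)\cong\bigoplus_{i=0}^{r}\bigl(F(x)(-i)\bigr)^{\alpha_i}\oplus\bigoplus_{i=1}^{r-1}\bigoplus_{j=1}^{r-i}\Bigl(\frac{F(x)}{(x^*)^jF(x)}(-i)\Bigr)^{\alpha_{i,j}} .$$ - An element $a\in\mathfrak m^s$ is superficial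 of degree $s$ if $\mathfrak m^{n+s}=a\mathfrak m^n$ for all large $n$. Let $A'$ be the first neighborhood ring of $A$: the subring of the total ring of fractions of $A$ consisting of all $b/a$ with $b\in\mathfrak m^s$ and $a$ superficial of degree $s$, for some $s\ge 0$. The micro-invariants of $A$ are, for $1\le i\le r$, $$\beta_i=\lambda\Bigl(\frac{A+\mathfrak m^{i-1}A'}{A+\mathfrak m^{i}A'}\Bigr)-\lambda\Bigl(\frac{A+\mathfrak m^{i}A'}{A+\mathfrak m^{i+1}A'}\Bigr).$$ - The Apery invariants of $A$ with respect to $x$ are, for $1\le i\le r$, $$\gamma_i=\lambda\Bigl(\frac{\mathfrak m^i+xA}{\mathfrak m^{i+1}+xA}\Bigr).$$ Assume that the ring $G(\mathfrak m)$ is Cohen–Macaulay. Then a decomposition of $G(\mathfrak m)$ as above exists, the lengths defining the $\beta_i$ are finite, and for every such decomposition and every $1\le i\le r$, $$0<\alpha_i=\beta_i=\gamma_i=\mu(\mathfrak m^{i})-\mu(\mathfrak m^{i-1}).$$ -/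

import Mathlib

open IsLocalRing
open scoped DirectSum nonZeroDivisors

noncomputable section

namespace MicroInvariants

/-! ### Cohen–Macaulay rings -/

/-- A Noetherian local ring is Cohen–Macaulay if its maximal ideal contains a regular sequence
whose length is the Krull dimension (that is, depth and dimension agree). -/
structure IsCohenMacaulayLocalRing (R : Type*) [CommRing R] [IsLocalRing R] : Prop where
  isNoetherianRing : IsNoetherianRing R
  exists_isRegular : ∃ rs : List R, (∀ a ∈ rs, a ∈ maximalIdeal R) ∧
    RingTheory.Sequence.IsRegular R rs ∧ (rs.length : WithBot ℕ∞) = ringKrullDim R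

/-- A commutative ring is Cohen–Macaulay if it is Noetherian and all its localizations at
maximal ideals are Cohen–Macaulay local rings. -/
structure IsCohenMacaulayRing (R : Type*) [CommRing R] : Prop where
  isNoetherianRing : IsNoetherianRing R
  localization : ∀ (p : Ideal R) [p.IsMaximal],
    IsCohenMacaulayLocalRing (Localization.AtPrime p)

/-! ### Reductions, reduction numbers, superficial elements, lengths -/

section Reductions

variable {A : Type*} [CommRing A]

/-- `J` is a reduction of `I`. -/
def IsReduction (J I : Ideal A) : Prop :=
  J ≤ I ∧ ∃ n : ℕ, I ^ (n + 1) = J * I ^ n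

/-- `J` is a minimal reduction of `I`: a reduction that is minimal for inclusion. -/
def IsMinimalReduction (J I : Ideal A) : Prop :=
  Minimal (fun J' => IsReduction J' I) J

theorem IsMinimalReduction.le {J I : Ideal A} (h : IsMinimalReduction J I) : J ≤ I :=
  h.prop.1

/-- The length `λ(M / N)` of the quotient of two submodules `N ≤ M`. -/
def quotLength {Q : Type*} [AddCommGroup Q] [Module A Q] (M N : Submodule A Q) : ℕ∞ :=
  Module.length A (↥M ⧸ N.submoduleOf M)

variable [IsLocalRing A]

/-- The reduction number of the maximal ideal `𝔪` with respect to `xA`: the least `r` such that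
`𝔪 ^ (r + 1) = x 𝔪 ^ r`. -/
def reductionNumber (x : A) : ℕ :=
  sInf {r : ℕ | maximalIdeal A ^ (r + 1) = Ideal.span {x} * maximalIdeal A ^ r}

/-- `a` is superficial of degree `s`: `a ∈ 𝔪 ^ s` and `𝔪 ^ (n + s) = a 𝔪 ^ n` for large `n`. -/
def IsSuperficial (s : ℕ) (a : A) : Prop :=
  a ∈ maximalIdeal A ^ s ∧
    ∀ᶠ n in Filter.atTop, maximalIdeal A ^ (n + s) = Ideal.span {a} * maximalIdeal A ^ n

theorem isSuperficial_one : IsSuperficial 0 (1 : A) :=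
  ⟨by simp, Filter.Eventually.of_forall fun n => by simp⟩

theorem IsSuperficial.mul {s t : ℕ} {a b : A} (ha : IsSuperficial s a) (hb : IsSuperficial t b) :
    IsSuperficial (s + t) (a * b) := by
  refine ⟨by rw [pow_add]; exact Ideal.mul_mem_mul ha.1 hb.1, ?_⟩
  have h := (Filter.tendsto_add_atTop_nat t).eventually ha.2
  filter_upwards [h, hb.2] with n h1 h2
  rw [show n + (s + t) = n + t + s by ring, h1, h2, ← mul_assoc,
    Ideal.span_singleton_mul_span_singleton]

/-- Number of generators `μ(𝔪 ^ n)`. -/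
def mu (A : Type*) [CommRing A] [IsLocalRing A] (n : ℕ) : ℕ :=
  (maximalIdeal A ^ n).spanFinrank

end Reductions

/-! ### The first neighborhood ring and the micro-invariants -/

section FirstNeighborhood

variable (A : Type*) [CommRing A] [IsLocalRing A]

/-- The first neighborhood ring `A'`: all elements `b / a` of the total ring of fractions of `A`
with `b ∈ 𝔪 ^ s` and `a` a (regular) superficial element of degree `s`, for some `s`. -/
def firstNeighborhood : Subalgebra A (FractionRing A) where
  carrier := {z | ∃ (s : ℕ) (b : A) (a : A⁰), b ∈ maximalIdeal A ^ s ∧ IsSuperficial s (a : A) ∧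
    z = IsLocalization.mk' (FractionRing A) b a}
  mul_mem' := by
    rintro _ _ ⟨s, b, a, hb, ha, rfl⟩ ⟨t, d, c, hd, hc, rfl⟩
    exact ⟨s + t, b * d, a * c, by rw [pow_add]; exact Ideal.mul_mem_mul hb hd, ha.mul hc,
      (IsLocalization.mk'_mul _ _ _ _ _).symm⟩
  add_mem' := by
    rintro _ _ ⟨s, b, a, hb, ha, rfl⟩ ⟨t, d, c, hd, hc, rfl⟩
    refine ⟨s + t, b * c + d * a, a * c, ?_, ha.mul hc, (IsLocalization.mk'_add _ _ _ _).symm⟩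
    refine add_mem ?_ ?_
    · rw [pow_add]; exact Ideal.mul_mem_mul hb hc.1
    · rw [pow_add, mul_comm d]; exact Ideal.mul_mem_mul ha.1 hd
  algebraMap_mem' := fun r =>
    ⟨0, r, 1, by simp, isSuperficial_one, (IsLocalization.mk'_one _ r).symm⟩

/-- The `A`-submodule `A + 𝔪 ^ i A'` of the total ring of fractions. -/
def neighborhoodLayer (i : ℕ) : Submodule A (FractionRing A) :=
  1 ⊔ maximalIdeal A ^ i • Subalgebra.toSubmodule (firstNeighborhood A)

/-- The length `λ((A + 𝔪 ^ i A') / (A + 𝔪 ^ (i + 1) A'))`. -/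
def layerLength (i : ℕ) : ℕ∞ :=
  quotLength (neighborhoodLayer A i) (neighborhoodLayer A (i + 1))

/-- The micro-invariant `β_i`, for `i ≥ 1`. -/
def microInvariant (i : ℕ) : ℤ :=
  ((layerLength A (i - 1)).toNat : ℤ) - ((layerLength A i).toNat : ℤ)

variable {A}

/-- The Apery invariant `γ_i = λ((𝔪 ^ i + xA) / (𝔪 ^ (i + 1) + xA))` with respect to `x`. -/
def aperyInvariant (x : A) (i : ℕ) : ℕ∞ :=
  quotLength (maximalIdeal A ^ i ⊔ Ideal.span {x}) (maximalIdeal A ^ (i + 1) ⊔ Ideal.span {x})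

end FirstNeighborhood

/-! ### The graded rings `⨁ J ^ n / 𝔪 J ^ n` -/

section FiberCone

variable {A : Type*} [CommRing A] [IsLocalRing A]

/-- The graded piece `J ^ n / 𝔪 J ^ n`. -/
def FiberPiece (J : Ideal A) (n : ℕ) : Type _ :=
  ↥(J ^ n) ⧸ (maximalIdeal A * J ^ n).submoduleOf (J ^ n)

instance (J : Ideal A) (n : ℕ) : AddCommGroup (FiberPiece J n) :=
  inferInstanceAs (AddCommGroup (↥(J ^ n) ⧸ (maximalIdeal A * J ^ n).submoduleOf (J ^ n)))

instance (J : Ideal A) (n : ℕ) : Module A (FiberPiece J n) :=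
  inferInstanceAs (Module A (↥(J ^ n) ⧸ (maximalIdeal A * J ^ n).submoduleOf (J ^ n)))

/-- The class of `a ∈ J ^ n` in `J ^ n / 𝔪 J ^ n`. -/
def FiberPiece.mk (J : Ideal A) (n : ℕ) : ↥(J ^ n) →ₗ[A] FiberPiece J n :=
  Submodule.mkQ _

theorem FiberPiece.mk_surjective (J : Ideal A) (n : ℕ) :
    Function.Surjective (FiberPiece.mk J n) :=
  Submodule.mkQ_surjective _

theorem FiberPiece.mk_eq_zero {J : Ideal A} {n : ℕ} {a : ↥(J ^ n)} :
    FiberPiece.mk J n a = 0 ↔ (a : A) ∈ maximalIdeal A * J ^ n :=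
  Submodule.Quotient.mk_eq_zero _

/-- Multiplication of representatives, with values in the graded piece. -/
def FiberPiece.preMul (J : Ideal A) (i j : ℕ) :
    ↥(J ^ i) →ₗ[A] ↥(J ^ j) →ₗ[A] FiberPiece J (i + j) :=
  LinearMap.mk₂ A
    (fun a b => FiberPiece.mk J (i + j)
      ⟨(a : A) * b, by rw [pow_add]; exact Ideal.mul_mem_mul a.2 b.2⟩)
    (fun a a' b => by rw [← map_add]; congr 1; ext; simp [add_mul])
    (fun c a b => by rw [← map_smul]; congr 1; ext; simp [mul_assoc])
    (fun a b b' => by rw [← map_add]; congr 1; ext; simp [mul_add])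
    (fun c a b => by rw [← map_smul]; congr 1; ext; simp [mul_left_comm])

theorem FiberPiece.preMul_apply (J : Ideal A) (i j : ℕ) (a : ↥(J ^ i)) (b : ↥(J ^ j)) :
    FiberPiece.preMul J i j a b = FiberPiece.mk J (i + j)
      ⟨(a : A) * b, by rw [pow_add]; exact Ideal.mul_mem_mul a.2 b.2⟩ :=
  rfl

/-- Linear maps out of a graded piece. -/
def FiberPiece.lift {J : Ideal A} {n : ℕ} {P : Type*} [AddCommGroup P] [Module A P]
    (f : ↥(J ^ n) →ₗ[A] P) (h : ∀ a : ↥(J ^ n), (a : A) ∈ maximalIdeal A * J ^ n → f a = 0) :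
    FiberPiece J n →ₗ[A] P :=
  Submodule.liftQ _ f (fun a ha => h a ha)

theorem FiberPiece.lift_mk {J : Ideal A} {n : ℕ} {P : Type*} [AddCommGroup P] [Module A P]
    (f : ↥(J ^ n) →ₗ[A] P) (h : ∀ a : ↥(J ^ n), (a : A) ∈ maximalIdeal A * J ^ n → f a = 0)
    (a : ↥(J ^ n)) : FiberPiece.lift f h (FiberPiece.mk J n a) = f a :=
  rfl

theorem FiberPiece.hom_ext {J : Ideal A} {n : ℕ} {P : Type*} [AddCommGroup P] [Module A P]
    {f g : FiberPiece J n →ₗ[A] P}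
    (h : ∀ a, f (FiberPiece.mk J n a) = g (FiberPiece.mk J n a)) : f = g := by
  refine LinearMap.ext fun b => ?_
  obtain ⟨a, rfl⟩ := FiberPiece.mk_surjective J n b
  exact h a

theorem FiberPiece.preMul_eq_zero_left {J : Ideal A} {i j : ℕ} {a : ↥(J ^ i)}
    (ha : (a : A) ∈ maximalIdeal A * J ^ i) (b : ↥(J ^ j)) : FiberPiece.preMul J i j a b = 0 := by
  rw [FiberPiece.preMul_apply, FiberPiece.mk_eq_zero]
  dsimp only
  rw [pow_add, ← mul_assoc]
  exact Ideal.mul_mem_mul ha b.2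

theorem FiberPiece.preMul_eq_zero_right {J : Ideal A} {i j : ℕ} (a : ↥(J ^ i)) {b : ↥(J ^ j)}
    (hb : (b : A) ∈ maximalIdeal A * J ^ j) : FiberPiece.preMul J i j a b = 0 := by
  rw [FiberPiece.preMul_apply, FiberPiece.mk_eq_zero]
  dsimp only
  rw [pow_add, mul_left_comm]
  exact Ideal.mul_mem_mul a.2 hb

/-- The multiplication `J ^ i / 𝔪 J ^ i × J ^ j / 𝔪 J ^ j → J ^ (i + j) / 𝔪 J ^ (i + j)`
induced by that of `A`. -/
def FiberPiece.mul (J : Ideal A) (i j : ℕ) :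
    FiberPiece J i →ₗ[A] FiberPiece J j →ₗ[A] FiberPiece J (i + j) :=
  FiberPiece.lift
    { toFun := fun a => FiberPiece.lift (FiberPiece.preMul J i j a)
        (fun _ hb => FiberPiece.preMul_eq_zero_right a hb)
      map_add' := fun a a' => FiberPiece.hom_ext fun b => by
        simp only [FiberPiece.lift_mk, LinearMap.add_apply, map_add]
      map_smul' := fun c a => FiberPiece.hom_ext fun b => by
        simp only [FiberPiece.lift_mk, LinearMap.smul_apply, map_smul, RingHom.id_apply] }
    (fun _ ha => FiberPiece.hom_ext fun b => by
      simp only [FiberPiece.lift_mk, LinearMap.coe_mk, AddHom.coe_mk, LinearMap.zero_apply]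
      exact FiberPiece.preMul_eq_zero_left ha b)

theorem FiberPiece.mul_mk_mk (J : Ideal A) (i j : ℕ) (a : ↥(J ^ i)) (b : ↥(J ^ j)) :
    FiberPiece.mul J i j (FiberPiece.mk J i a) (FiberPiece.mk J j b) =
      FiberPiece.mk J (i + j)
        ⟨(a : A) * b, by rw [pow_add]; exact Ideal.mul_mem_mul a.2 b.2⟩ :=
  rfl

theorem FiberPiece.sigma_ext {J : Ideal A} {i j : ℕ} (h : i = j) {a b : A} (ha : a ∈ J ^ i)
    (hb : b ∈ J ^ j) (hab : a = b) :
    GradedMonoid.mk (A := FiberPiece J) i (FiberPiece.mk J i ⟨a, ha⟩) =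
      GradedMonoid.mk j (FiberPiece.mk J j ⟨b, hb⟩) := by
  subst h
  subst hab
  rfl

instance (J : Ideal A) : GradedMonoid.GOne (FiberPiece J) where
  one := FiberPiece.mk J 0 ⟨1, by simp⟩

instance (J : Ideal A) : GradedMonoid.GMul (FiberPiece J) where
  mul {i j} a b := FiberPiece.mul J i j a b

instance (J : Ideal A) : DirectSum.GCommRing (FiberPiece J) where
  mul_zero a := map_zero (FiberPiece.mul J _ _ a)
  zero_mul b := LinearMap.map_zero₂ (FiberPiece.mul J _ _) b
  mul_add a b c := map_add (FiberPiece.mul J _ _ a) b c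
  add_mul a b c := LinearMap.map_add₂ (FiberPiece.mul J _ _) a b c
  one_mul := by
    rintro ⟨i, a⟩
    obtain ⟨a, rfl⟩ := FiberPiece.mk_surjective J i a
    exact FiberPiece.sigma_ext (zero_add i) _ _ (one_mul (a : A))
  mul_one := by
    rintro ⟨i, a⟩
    obtain ⟨a, rfl⟩ := FiberPiece.mk_surjective J i a
    exact FiberPiece.sigma_ext (add_zero i) _ _ (mul_one (a : A))
  mul_assoc := by
    rintro ⟨i, a⟩ ⟨j, b⟩ ⟨k, c⟩
    obtain ⟨a, rfl⟩ := FiberPiece.mk_surjective J i a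
    obtain ⟨b, rfl⟩ := FiberPiece.mk_surjective J j b
    obtain ⟨c, rfl⟩ := FiberPiece.mk_surjective J k c
    exact FiberPiece.sigma_ext (add_assoc i j k) _ _ (mul_assoc (a : A) b c)
  mul_comm := by
    rintro ⟨i, a⟩ ⟨j, b⟩
    obtain ⟨a, rfl⟩ := FiberPiece.mk_surjective J i a
    obtain ⟨b, rfl⟩ := FiberPiece.mk_surjective J j b
    exact FiberPiece.sigma_ext (add_comm i j) _ _ (mul_comm (a : A) b)
  natCast n := FiberPiece.mk J 0 ⟨n, by simp⟩
  natCast_zero := by rw [← map_zero (FiberPiece.mk J 0)]; congr 1; ext; simp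
  natCast_succ n := by
    change _ = FiberPiece.mk J 0 _ + FiberPiece.mk J 0 _
    rw [← map_add]; congr 1; ext; simp
  intCast n := FiberPiece.mk J 0 ⟨n, by simp⟩
  intCast_ofNat n := by congr 1; ext; simp
  intCast_negSucc_ofNat n := by
    rw [← map_neg]; congr 1; ext; simp

/-- The graded ring `⨁ J ^ n / 𝔪 J ^ n`. -/
abbrev FiberCone (J : Ideal A) : Type _ := ⨁ n : ℕ, FiberPiece J n

/-- The tangent cone `G(𝔪) = ⨁ 𝔪 ^ n / 𝔪 ^ (n + 1)`, where `𝔪 ^ (n + 1)` appears as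
`𝔪 * 𝔪 ^ n`. -/
abbrev TangentCone (A : Type*) [CommRing A] [IsLocalRing A] : Type _ :=
  FiberCone (maximalIdeal A)

/-- The graded ring `F(x) = ⨁ x ^ n A / x ^ n 𝔪`. -/
abbrev NoetherNormalization (x : A) : Type _ := FiberCone (Ideal.span {x})

/-- The map `J ^ n / 𝔪 J ^ n → K ^ n / 𝔪 K ^ n` induced by an inclusion `J ≤ K`. -/
def FiberPiece.map {J K : Ideal A} (h : J ≤ K) (n : ℕ) : FiberPiece J n →ₗ[A] FiberPiece K n :=
  Submodule.mapQ _ _ (Submodule.inclusion (Ideal.pow_right_mono h n))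
    (fun _ ha => Ideal.mul_mono_right (Ideal.pow_right_mono h n) ha)

theorem FiberPiece.map_mk {J K : Ideal A} (h : J ≤ K) (n : ℕ) (a : ↥(J ^ n)) :
    FiberPiece.map h n (FiberPiece.mk J n a) =
      FiberPiece.mk K n ⟨a, Ideal.pow_right_mono h n a.2⟩ :=
  rfl

theorem FiberPiece.map_mul {J K : Ideal A} (h : J ≤ K) {i j : ℕ} (a : FiberPiece J i)
    (b : FiberPiece J j) :
    FiberPiece.map h (i + j) (FiberPiece.mul J i j a b) =
      FiberPiece.mul K i j (FiberPiece.map h i a) (FiberPiece.map h j b) := by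
  obtain ⟨a, rfl⟩ := FiberPiece.mk_surjective J i a
  obtain ⟨b, rfl⟩ := FiberPiece.mk_surjective J j b
  simp only [FiberPiece.mul_mk_mk, FiberPiece.map_mk]

/-- The homomorphism of graded rings induced by an inclusion `J ≤ K`. For `J = xA` and `K = 𝔪`
this is the natural map `F(x) → G(𝔪)`. -/
def fiberConeMap {J K : Ideal A} (h : J ≤ K) : FiberCone J →+* FiberCone K :=
  DirectSum.toSemiring
    (fun n => (DirectSum.of (FiberPiece K) n).comp (FiberPiece.map h n).toAddMonoidHom)
    rfl
    (fun {i j} a b => by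
      simp only [AddMonoidHom.comp_apply, LinearMap.toAddMonoidHom_coe, DirectSum.of_mul_of]
      exact congrArg _ (FiberPiece.map_mul h a b))

theorem fiberConeMap_of {J K : Ideal A} (h : J ≤ K) (n : ℕ) (a : FiberPiece J n) :
    fiberConeMap h (DirectSum.of (FiberPiece J) n a) =
      DirectSum.of (FiberPiece K) n (FiberPiece.map h n a) :=
  DirectSum.toSemiring_of _ _ _ _ _

/-- The element `x*` of `F(x)`: the class of `x` in `xA / x𝔪`. -/
def xStar (x : A) : NoetherNormalization x :=
  DirectSum.of (FiberPiece (Ideal.span {x})) 1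
    (FiberPiece.mk _ 1 ⟨x, by rw [pow_one]; exact Ideal.mem_span_singleton_self x⟩)

/-- The homogeneous elements of degree `d` of the fiber cone. -/
def degreePart (J : Ideal A) (d : ℕ) : AddSubgroup (FiberCone J) :=
  (DirectSum.of (FiberPiece J) d).range

/-- The degree `d` part `F(-i)_d` of the shift by `-i` of `F = F(x)`: it is `F_{d - i}` if
`i ≤ d` and zero otherwise. -/
def shiftedDegreePart (x : A) (i d : ℕ) : AddSubgroup (NoetherNormalization x) :=
  if i ≤ d then degreePart (Ideal.span {x}) (d - i) else ⊥

/-- The quotient `F(x) / (x*) ^ j F(x)`. -/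
abbrev TorsionQuotient (x : A) (j : ℕ) : Type _ :=
  NoetherNormalization x ⧸ Ideal.span {xStar x ^ j}

/-- The degree `d` part of `(F(x) / (x*) ^ j F(x))(-i)`. -/
def torsionDegreePart (x : A) (j i d : ℕ) : AddSubgroup (TorsionQuotient x j) :=
  (shiftedDegreePart x i d).map (Ideal.Quotient.mk (Ideal.span {xStar x ^ j})).toAddMonoidHom

/-- Indices of the summands `F(x)(-i)`, `0 ≤ i ≤ r`, the `i`-th one occurring `α i` times. -/
abbrev FreeIndex (r : ℕ) (α : ℕ → ℕ) : Type :=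
  Σ i : ↥(Finset.Icc 0 r), Fin (α i)

/-- Indices of the summands `(F(x) / (x*) ^ j F(x))(-i)`, `1 ≤ i ≤ r - 1`, `1 ≤ j ≤ r - i`, the
`(i, j)`-th one occurring `τ i j` times. -/
abbrev TorsionIndex (r : ℕ) (τ : ℕ → ℕ → ℕ) : Type :=
  Σ i : ↥(Finset.Icc 1 (r - 1)), Σ j : ↥(Finset.Icc 1 (r - i)), Fin (τ i j)

/-- `α_i` (`0 ≤ i ≤ r`) and `α_{i,j} = τ i j` (`1 ≤ i ≤ r - 1`, `1 ≤ j ≤ r - i`) are the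
invariants of the tangent cone with respect to `x`: there is an isomorphism of graded
`F(x)`-modules
`G(𝔪) ≅ ⨁_i F(x)(-i) ^ {α_i} ⊕ ⨁_{i,j} (F(x) / (x*) ^ j F(x))(-i) ^ {α_{i,j}}`,
that is, an additive bijection that is `F(x)`-linear and identifies the parts of each degree.
Here `F(x)` acts on `G(𝔪)` through the natural map `F(x) → G(𝔪)`. -/
def IsTangentConeInvariants (x : A) (hx : Ideal.span {x} ≤ maximalIdeal A)
    (α : ℕ → ℕ) (τ : ℕ → ℕ → ℕ) : Prop :=
  ∃ e : TangentCone A ≃+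
      ((FreeIndex (reductionNumber x) α → NoetherNormalization x) ×
        ((k : TorsionIndex (reductionNumber x) τ) → TorsionQuotient x k.2.1)),
    (∀ (f : NoetherNormalization x) (g : TangentCone A), e (fiberConeMap hx f * g) = f • e g) ∧
    ∀ (d : ℕ) (g : TangentCone A), g ∈ degreePart (maximalIdeal A) d ↔
      (∀ k, (e g).1 k ∈ shiftedDegreePart x k.1 d) ∧
      (∀ k, (e g).2 k ∈ torsionDegreePart x k.2.1 k.1 d)

end FiberCone

end MicroInvariants

end

open MicroInvariants

/-! Write `G` for the tangent cone, `F` for `F(x)`, `λ_i` for `layerLength A i` and `μ_i` for `mu A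
i`. Everything rests on one fact: the initial form `x*` of `x` is a nonzerodivisor on `G`
(`mem_pow_succ_of_reduction_mul_mem`). To get it, localize `G` at its augmentation ideal. Positive
dimension of `A` keeps `x*` from being nilpotent there, so the regular sequence is nonempty, and no
nonzero homogeneous element is killed by everything of positive degree. Since `𝔪^(k+1) = x𝔪^k` for
large `k`, an element killed by `x*` is killed in all high degrees; descending on the degree, it is
zero.

Regularity makes multiplication by `x^(j-i)` injective from `G_i` to `G_j`, with cokernel `𝔪^j /
(x^(j-i)𝔪^i + 𝔪^(j+1))` (`length_quotient_add_mu`). For `j = i + 1` the cokernel has length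
`γ_{i+1}`, so `γ_{i+1} = μ_{i+1} - μ_i`. For `j = r`, the equality `A' = 𝔪^r / x^r` identifies the
cokernel with the quotient of layers, so `λ_i = μ_r - μ_i` and `β_i = λ_{i-1} - λ_i = μ_i -
μ_{i-1}`.

Lifts of bases of `G_d / x*G_{d-1}` for `d ≤ r` form a homogeneous basis of `G` over `F`, which
gives a decomposition. In any decomposition the torsion part vanishes because `x*` is regular, and
counting lengths in degree `d` gives `μ_d = α_0 + ... + α_d` for `d ≤ r`. Positivity is Nakayama's
lemma together with the minimality of `r`. -/

noncomputable section

namespace MicroInvariants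

/-! ### Fiber cones on representatives, and the augmentation to the residue field. -/

section Augmentation

variable {A : Type*} [CommRing A] [IsLocalRing A]

theorem of_mk_mul_of_mk {J : Ideal A} (i j : ℕ) (a : ↥(J ^ i)) (b : ↥(J ^ j)) :
    (DirectSum.of (FiberPiece J) i (FiberPiece.mk J i a) : FiberCone J) *
      DirectSum.of (FiberPiece J) j (FiberPiece.mk J j b) =
      DirectSum.of (FiberPiece J) (i + j) (FiberPiece.mk J (i + j)
        ⟨(a : A) * b, by rw [pow_add]; exact Ideal.mul_mem_mul a.2 b.2⟩) := by
  rw [DirectSum.of_mul_of]; rfl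

/-- Compares homogeneous elements whose degrees are equal only propositionally, so that no cast
between graded pieces is needed. -/
theorem of_mk_congr {J : Ideal A} {i j : ℕ} (h : i = j) {a b : A} (ha : a ∈ J ^ i)
    (hb : b ∈ J ^ j) (hab : a = b) :
    (DirectSum.of (FiberPiece J) i (FiberPiece.mk J i ⟨a, ha⟩) : FiberCone J) =
      DirectSum.of (FiberPiece J) j (FiberPiece.mk J j ⟨b, hb⟩) :=
  DirectSum.of_eq_of_gradedMonoid_eq (FiberPiece.sigma_ext h ha hb hab)

/-- Induction on elements of a fiber cone, with explicit representatives. -/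
theorem fiberCone_induction {J : Ideal A} {p : FiberCone J → Prop} (f : FiberCone J)
    (zero : p 0) (of_mk : ∀ n a, p (DirectSum.of (FiberPiece J) n (FiberPiece.mk J n a)))
    (add : ∀ f g, p f → p g → p (f + g)) : p f := by
  induction f using DirectSum.induction_on with
  | zero => exact zero
  | of n a => obtain ⟨a, rfl⟩ := FiberPiece.mk_surjective J n a; exact of_mk n a
  | add f g hf hg => exact add f g hf hg

theorem smul_eq_of_zero_mul {J : Ideal A} (c : A) (f : FiberCone J) :
    c • f = DirectSum.of (FiberPiece J) 0 (FiberPiece.mk J 0 ⟨c, by simp⟩) * f := by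
  induction f using fiberCone_induction with
  | zero => simp
  | of_mk n a =>
    rw [of_mk_mul_of_mk]
    change c • (DirectSum.lof A ℕ (FiberPiece J) n _) = _
    rw [← map_smul, ← map_smul]
    exact of_mk_congr (zero_add n).symm _ _ rfl
  | add f g hf hg => rw [smul_add, mul_add, hf, hg]

/-- The residue class of an element of `J ^ n` if `n = 0`, and zero otherwise. -/
def FiberPiece.preAugmentation (J : Ideal A) (n : ℕ) : ↥(J ^ n) →ₗ[A] ResidueField A where
  toFun a := if n = 0 then residue A a else 0
  map_add' a b := by split_ifs <;> simp
  map_smul' c a := by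
    split_ifs
    · simp [Algebra.smul_def]
    · simp

theorem FiberPiece.preAugmentation_apply (J : Ideal A) (n : ℕ) (a : ↥(J ^ n)) :
    FiberPiece.preAugmentation J n a = if n = 0 then residue A a else 0 :=
  rfl

/-- The component in degree zero, as an element of the residue field. -/
def FiberPiece.augmentation {J : Ideal A} (n : ℕ) :
    FiberPiece J n →ₗ[A] ResidueField A :=
  FiberPiece.lift (FiberPiece.preAugmentation J n) (fun a ha => by
    have h : residue A (a : A) = 0 :=
      (residue_eq_zero_iff (a : A)).2 ((Ideal.mul_le_inf ha).1)
    rw [FiberPiece.preAugmentation_apply, h, ite_self])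

theorem FiberPiece.augmentation_mk {J : Ideal A} (n : ℕ) (a : ↥(J ^ n)) :
    FiberPiece.augmentation n (FiberPiece.mk J n a) = if n = 0 then residue A a else 0 :=
  FiberPiece.lift_mk _ _ a

/-- The augmentation of a fiber cone, with values in the residue field. -/
def augmentation (J : Ideal A) : FiberCone J →+* ResidueField A :=
  DirectSum.toSemiring (fun n => (FiberPiece.augmentation n).toAddMonoidHom)
    ((FiberPiece.augmentation_mk 0 _).trans (by simp))
    (fun {i j} a b => by
      obtain ⟨a, rfl⟩ := FiberPiece.mk_surjective J i a
      obtain ⟨b, rfl⟩ := FiberPiece.mk_surjective J j b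
      refine (FiberPiece.augmentation_mk (i + j) ⟨(a : A) * b, by
        rw [pow_add]; exact Ideal.mul_mem_mul a.2 b.2⟩).trans ?_
      refine Eq.trans ?_ (congrArg₂ (· * ·) (FiberPiece.augmentation_mk i a)
        (FiberPiece.augmentation_mk j b)).symm
      by_cases hi : i = 0 <;> by_cases hj : j = 0 <;> simp [hi, hj])

theorem augmentation_of_mk (J : Ideal A) (n : ℕ) (a : ↥(J ^ n)) :
    augmentation J (DirectSum.of (FiberPiece J) n (FiberPiece.mk J n a)) =
      if n = 0 then residue A a else 0 :=
  (DirectSum.toSemiring_of _ _ _ _ _).trans (FiberPiece.augmentation_mk n a)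

theorem augmentation_surjective (J : Ideal A) :
    Function.Surjective (augmentation J) := fun c => by
  obtain ⟨c, rfl⟩ := residue_surjective c
  exact ⟨DirectSum.of _ 0 (FiberPiece.mk J 0 ⟨c, by simp⟩), by simp [augmentation_of_mk]⟩

theorem FiberPiece.smul_eq_zero {J : Ideal A} {n : ℕ} {c : A} (hc : c ∈ maximalIdeal A)
    (z : FiberPiece J n) : c • z = 0 := by
  obtain ⟨a, rfl⟩ := FiberPiece.mk_surjective J n z
  rw [← map_smul, FiberPiece.mk_eq_zero]
  exact Ideal.mul_mem_mul hc a.2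

/-- The component of degree `n` of a product with a homogeneous element of degree `n`. -/
theorem exists_mul_of_apply {J : Ideal A} (s : FiberCone J) (n : ℕ)
    (z : FiberPiece J n) : ∃ c : A, residue A c = augmentation J s ∧
      (s * DirectSum.of (FiberPiece J) n z) n = c • z := by
  obtain ⟨b, rfl⟩ := FiberPiece.mk_surjective J n z
  induction s using fiberCone_induction with
  | zero => exact ⟨0, by simp, by simp⟩
  | of_mk i a =>
    rw [of_mk_mul_of_mk, augmentation_of_mk]
    by_cases hi : i = 0
    · subst hi
      refine ⟨a, by simp, ?_⟩
      rw [of_mk_congr (b := (a : A) * b) (zero_add n) _ (Ideal.mul_mem_left _ _ b.2) rfl,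
        DirectSum.of_eq_same]
      rfl
    · refine ⟨0, by simp [hi], ?_⟩
      rw [DirectSum.of_eq_of_ne _ _ _ (by omega), zero_smul]
  | add f g hf hg =>
    obtain ⟨c, hc, hc'⟩ := hf
    obtain ⟨d, hd, hd'⟩ := hg
    exact ⟨c + d, by simp [hc, hd], by rw [add_mul, DirectSum.add_apply, hc', hd', add_smul]⟩

/-- Only the augmentation matters when multiplying elements killed in positive degrees. -/
theorem mul_of_eq_zero {J : Ideal A} {n : ℕ} {z : FiberPiece J n}
    (hz : ∀ i, i ≠ 0 → ∀ b : ↥(J ^ i), DirectSum.of (FiberPiece J) i (FiberPiece.mk J i b) *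
      DirectSum.of (FiberPiece J) n z = 0) {s : FiberCone J} (hs : augmentation J s = 0) :
    s * DirectSum.of (FiberPiece J) n z = 0 := by
  -- Every `s` acts on `z` through its degree-zero component alone, hence as a scalar lifting its
  -- augmentation.
  have key : ∀ s : FiberCone J, ∃ c : A, residue A c = augmentation J s ∧
      s * DirectSum.of (FiberPiece J) n z = c • DirectSum.of (FiberPiece J) n z := by
    intro s
    induction s using fiberCone_induction with
    | zero => exact ⟨0, by simp, by simp⟩
    | of_mk i a =>
      rw [augmentation_of_mk]
      by_cases hi : i = 0
      · subst hi
        exact ⟨a, by simp, (smul_eq_of_zero_mul _ _).symm⟩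
      · exact ⟨0, by simp [hi], by rw [hz i hi, zero_smul]⟩
    | add f g hf hg =>
      obtain ⟨c, hc, hc'⟩ := hf
      obtain ⟨d, hd, hd'⟩ := hg
      exact ⟨c + d, by simp [hc, hd], by rw [add_mul, hc', hd', add_smul]⟩
  obtain ⟨c, hc, hc'⟩ := key s
  rw [hs, residue_eq_zero_iff] at hc
  rw [hc']
  change c • DirectSum.lof A ℕ (FiberPiece J) n z = 0
  rw [← map_smul, FiberPiece.smul_eq_zero hc, map_zero]

end Augmentation

/-! ### Regularity of the initial form of `x`. -/

section TangentConeRegular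

variable {A : Type*} [CommRing A] [IsLocalRing A]

theorem reductionNumber_spec {x : A} (hx : IsReduction (Ideal.span {x}) (maximalIdeal A)) :
    maximalIdeal A ^ (reductionNumber x + 1) =
      Ideal.span {x} * maximalIdeal A ^ reductionNumber x :=
  Nat.sInf_mem (s := {r : ℕ | maximalIdeal A ^ (r + 1) = Ideal.span {x} * maximalIdeal A ^ r}) hx.2

theorem pow_add_eq_of_pow_succ_eq {R : Type*} [CommRing R] {I : Ideal R} {x : R} {r : ℕ}
    (h : I ^ (r + 1) = Ideal.span {x} * I ^ r) (n : ℕ) :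
    I ^ (n + r) = Ideal.span {x ^ n} * I ^ r := by
  induction n with
  | zero => simp
  | succ n ih =>
    rw [show n + 1 + r = (n + r) + 1 by ring, pow_succ, ih, mul_assoc, ← pow_succ, h, ← mul_assoc,
      Ideal.span_singleton_mul_span_singleton, pow_succ]

theorem krullDimLE_zero_of_pow_eq_bot {n : ℕ} (h : maximalIdeal A ^ n = ⊥) :
    Ring.KrullDimLE 0 A := by
  refine (((Ring.krullDimLE_zero_and_isLocalRing_tfae A).out 2 0 rfl rfl).mp fun x => ⟨?_, ?_⟩).1
  · rintro hx hu
    exact hx.not_isUnit hu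
  · intro hx
    exact ⟨n, by
      have := Ideal.pow_mem_pow ((mem_maximalIdeal x).2 hx) n
      rwa [h] at this⟩

/-- Powers of a reduction stay nonzero in the tangent cone when `dim A > 0`. -/
theorem pow_notMem_of_reduction [IsNoetherianRing A] {x : A} {r : ℕ}
    (hr : maximalIdeal A ^ (r + 1) = Ideal.span {x} * maximalIdeal A ^ r)
    (hdim : ¬ Ring.KrullDimLE 0 A) (n : ℕ) : x ^ n ∉ maximalIdeal A ^ (n + 1) := by
  intro h
  refine hdim (krullDimLE_zero_of_pow_eq_bot (n := n + r) ?_)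
  -- Nakayama: if `x^n ∈ 𝔪^(n+1)`, then `𝔪^(n+r) = x^n 𝔪^r ⊆ 𝔪 · 𝔪^(n+r)`.
  refine Submodule.eq_bot_of_le_smul_of_le_jacobson_bot (maximalIdeal A) _
    (IsNoetherian.noetherian _) ?_ (maximalIdeal_le_jacobson _)
  rw [smul_eq_mul, ← pow_succ', pow_add_eq_of_pow_succ_eq hr, add_right_comm, pow_add]
  exact Ideal.mul_mono_left ((Ideal.span_singleton_le_iff_mem _).2 h)

/-- If the tangent cone is Cohen–Macaulay and `A` has positive dimension, then nonzero homogeneous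
elements are not killed by all homogeneous elements of positive degree. -/
theorem mem_pow_succ_of_mul_mem [IsNoetherianRing A] {x : A}
    (hG : IsCohenMacaulayRing (TangentCone A))
    (hx : IsReduction (Ideal.span {x}) (maximalIdeal A))
    (hdim : ¬ Ring.KrullDimLE 0 A) {n : ℕ} {a : A} (ha : a ∈ maximalIdeal A ^ n)
    (h : ∀ i, i ≠ 0 → ∀ b ∈ maximalIdeal A ^ i, b * a ∈ maximalIdeal A ^ (i + n + 1)) :
    a ∈ maximalIdeal A ^ (n + 1) := by
  set M := RingHom.ker (augmentation (maximalIdeal A)) with hM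
  have hmax : M.IsMaximal :=
    RingHom.ker_isMaximal_of_surjective _ (augmentation_surjective (maximalIdeal A))
  have hCM := hG.localization M
  -- Homogeneous elements survive localization: a denominator `s` outside `M` has a unit as its
  -- degree-zero component, and that unit acts on `w` in degree `k` of `s * w`.
  have hzero : ∀ (k : ℕ) (w : FiberPiece (maximalIdeal A) k),
      algebraMap (TangentCone A) (Localization.AtPrime M) (DirectSum.of _ k w) = 0 → w = 0 := by
    intro k w hw
    obtain ⟨s, hs⟩ := (IsLocalization.map_eq_zero_iff M.primeCompl _ _).1 hw
    obtain ⟨c, hc, hc'⟩ := exists_mul_of_apply (s : TangentCone A) k w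
    rw [hs, DirectSum.zero_apply] at hc'
    have hu : IsUnit c := by
      by_contra hcu
      rw [(residue_eq_zero_iff c).2 ((mem_maximalIdeal c).2 hcu)] at hc
      exact s.2 (RingHom.mem_ker.2 hc.symm)
    exact hu.smul_eq_zero.1 hc'.symm
  obtain ⟨rs, hrs, hreg, hlen⟩ := hCM.exists_isRegular
  have := hCM.isNoetherianRing
  cases rs with
  -- An empty sequence means dimension zero, so the initial form of `x`, which lies in `M`, is
  -- nilpotent in the localization; then `x^k ∈ 𝔪^(k+1)` for some `k`, which is impossible.
  | nil =>
    exfalso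
    have hd : Ring.KrullDimLE 0 (Localization.AtPrime M) :=
      Ring.krullDimLE_iff.2 (by rw [← hlen]; simp)
    have hX : x ∈ maximalIdeal A ^ 1 := by
      rw [pow_one]; exact hx.1 (Ideal.mem_span_singleton_self x)
    set X : TangentCone A := DirectSum.of _ 1 (FiberPiece.mk _ 1 ⟨x, hX⟩) with hXdef
    have hXpow : ∀ k, X ^ k = DirectSum.of _ k (FiberPiece.mk _ k ⟨x ^ k, by
        simpa using Ideal.pow_mem_pow hX k⟩) := by
      intro k
      induction k with
      | zero => rw [pow_zero]; exact of_mk_congr rfl (by simp) _ (pow_zero x).symm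
      | succ k ih =>
        rw [pow_succ, ih, hXdef, of_mk_mul_of_mk]
        exact of_mk_congr rfl _ _ (pow_succ x k).symm
    have hXM : X ∈ M := by
      rw [hM, RingHom.mem_ker, hXdef, augmentation_of_mk, if_neg one_ne_zero]
    obtain ⟨k, hk⟩ := Ring.KrullDimLE.isNilpotent_iff_mem_maximalIdeal.2
      ((IsLocalization.AtPrime.to_map_mem_maximal_iff (Localization.AtPrime M) M X).2 hXM)
    rw [← map_pow, hXpow] at hk
    have := FiberPiece.mk_eq_zero.1 (hzero _ _ hk)
    rw [← pow_succ'] at this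
    exact pow_notMem_of_reduction (reductionNumber_spec hx) hdim k this
  -- The first term is a nonzerodivisor `p / s` with `p ∈ M`. The class of `a` is killed by `p`,
  -- hence vanishes in the localization and then in the tangent cone.
  | cons y rs =>
    have hy := ((RingTheory.Sequence.isRegular_cons_iff _ _ _).1 hreg).1
    obtain ⟨p, s, rfl⟩ := IsLocalization.exists_mk'_eq M.primeCompl y
    have hpM : p ∈ M := (IsLocalization.AtPrime.mk'_mem_maximal_iff (Localization.AtPrime M) M
      p s).1 (hrs _ (by simp))
    have hp := mul_of_eq_zero (z := FiberPiece.mk _ n ⟨a, ha⟩) (fun i hi b => by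
      rw [of_mk_mul_of_mk, FiberPiece.mk_eq_zero.2, map_zero]
      rw [← pow_succ']
      exact h i hi b b.2) (RingHom.mem_ker.1 hpM)
    have h0 := hzero n (FiberPiece.mk _ n ⟨a, ha⟩) (hy (by
      simp only [smul_eq_mul, mul_zero]
      rw [IsLocalization.mk'_eq_mul_mk'_one, mul_right_comm, ← map_mul, hp, map_zero, zero_mul]))
    rw [pow_succ']
    exact FiberPiece.mk_eq_zero.1 h0

/-- The initial form of `x` is a nonzerodivisor on the tangent cone. -/
theorem mem_pow_succ_of_reduction_mul_mem [IsNoetherianRing A] {x : A}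
    (hG : IsCohenMacaulayRing (TangentCone A))
    (hx : IsReduction (Ideal.span {x}) (maximalIdeal A))
    (hdim : ¬ Ring.KrullDimLE 0 A) {n : ℕ} {a : A} (ha : a ∈ maximalIdeal A ^ n)
    (hxa : x * a ∈ maximalIdeal A ^ (n + 2)) : a ∈ maximalIdeal A ^ (n + 1) := by
  have hr := reductionNumber_spec hx
  set r := reductionNumber x
  -- Beyond degree `r` every `b` has the form `x * c` with `c` one degree lower, so the hypothesis
  -- on `x * a` applies.
  have hbig : ∀ k, r < k → ∀ b ∈ maximalIdeal A ^ k, b * a ∈ maximalIdeal A ^ (k + n + 1) := by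
    intro k hk b hb
    obtain ⟨k, rfl⟩ := Nat.exists_eq_add_of_le' (Nat.succ_le_of_lt hk)
    rw [show k + r.succ = (k + 1) + r by omega, pow_add_eq_of_pow_succ_eq hr, pow_succ',
      ← Ideal.span_singleton_mul_span_singleton, mul_assoc, ← pow_add_eq_of_pow_succ_eq hr] at hb
    obtain ⟨c, hc, rfl⟩ := Ideal.mem_span_singleton_mul.1 hb
    rw [show x * c * a = c * (x * a) by ring, show k + r.succ + n + 1 = (k + r) + (n + 2) by
      omega, pow_add]
    exact Ideal.mul_mem_mul hc hxa
  -- Descending induction on `k`, with `j` measuring the distance to the range `k > r`. If the claim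
  -- holds in all larger degrees, the class of `b * a` is killed by everything of positive degree.
  -- The goal is the case `k = 0`, `b = 1`.
  have hall : ∀ j k, r < k + j → ∀ b ∈ maximalIdeal A ^ k,
      b * a ∈ maximalIdeal A ^ (k + n + 1) := by
    intro j
    induction j with
    | zero => exact fun k hk => hbig k hk
    | succ j ih =>
      intro k hk b hb
      refine mem_pow_succ_of_mul_mem hG hx hdim (n := k + n)
        (by rw [pow_add]; exact Ideal.mul_mem_mul hb ha) fun i hi c hc => ?_
      rw [← mul_assoc, ← add_assoc]
      exact ih (i + k) (by omega) (c * b) (by rw [pow_add]; exact Ideal.mul_mem_mul hc hb)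
  simpa using hall (r + 1) 0 (by omega) 1 (by simp)

end TangentConeRegular

/-! ### Lengths of cokernels of multiplication by powers of `x`. -/

section Lengths

theorem quotLength_eq_of_linearMap {A P Q : Type*} [CommRing A] [AddCommGroup P] [Module A P]
    [AddCommGroup Q] [Module A Q] (f : P →ₗ[A] Q) {M N : Submodule A Q} (h : M = LinearMap.range f ⊔ N) :
    quotLength M N = Module.length A (P ⧸ N.comap f) := by
  have hf : ∀ p, f p ∈ M := fun p => h ▸ Submodule.mem_sup_left (LinearMap.mem_range_self f p)
  let g : P →ₗ[A] (↥M ⧸ N.submoduleOf M) := (N.submoduleOf M).mkQ.comp (f.codRestrict M hf)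
  have hker : LinearMap.ker g = N.comap f := by
    ext p
    rw [LinearMap.mem_ker, LinearMap.comp_apply, Submodule.mkQ_apply,
      Submodule.Quotient.mk_eq_zero]
    rfl
  have hsurj : Function.Surjective g := by
    intro q
    obtain ⟨⟨m, hm⟩, rfl⟩ := Submodule.mkQ_surjective _ q
    rw [h] at hm
    obtain ⟨_, ⟨p, rfl⟩, b, hb, rfl⟩ := Submodule.mem_sup.1 hm
    refine ⟨p, ?_⟩
    rw [← sub_eq_zero, LinearMap.comp_apply, ← map_sub, Submodule.mkQ_apply,
      Submodule.Quotient.mk_eq_zero]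
    change f p - (f p + b) ∈ N
    simpa using hb
  rw [quotLength, ← hker]
  exact (g.quotKerEquivOfSurjective hsurj).length_eq.symm

variable {A : Type*} [CommRing A] [IsLocalRing A]

/-- Regularity on each graded piece upgrades to `(𝔪^(n+k) : x^k) = 𝔪^n`: climb the `𝔪`-adic
filtration one step at a time, starting from `a ∈ 𝔪^0`. -/
theorem mem_pow_of_pow_mul_mem {x : A}
    (hreg : ∀ (n : ℕ) (a : A), a ∈ maximalIdeal A ^ n → x * a ∈ maximalIdeal A ^ (n + 2) →
      a ∈ maximalIdeal A ^ (n + 1)) (k n : ℕ) {a : A}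
    (h : x ^ k * a ∈ maximalIdeal A ^ (n + k)) : a ∈ maximalIdeal A ^ n := by
  have step : ∀ (n : ℕ) (a : A), x * a ∈ maximalIdeal A ^ (n + 1) → a ∈ maximalIdeal A ^ n := by
    intro n
    induction n with
    | zero => intro a _; simp
    | succ n ih => exact fun a ha => hreg n a (ih a (Ideal.pow_le_pow_right (by omega) ha)) ha
  induction k with
  | zero => simpa using h
  | succ k ih =>
    refine ih (step _ _ ?_)
    rwa [← mul_assoc, ← pow_succ']

/-- An element killed by `x` lies in every power of `𝔪`, hence is zero by Krull's intersection
theorem. -/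
theorem mem_nonZeroDivisors_of_regular [IsNoetherianRing A] {x : A}
    (hreg : ∀ (n : ℕ) (a : A), a ∈ maximalIdeal A ^ n → x * a ∈ maximalIdeal A ^ (n + 2) →
      a ∈ maximalIdeal A ^ (n + 1)) : x ∈ A⁰ := by
  rw [mem_nonZeroDivisors_iff_right]
  intro a ha
  have h : a ∈ ⨅ n, maximalIdeal A ^ n := by
    rw [Submodule.mem_iInf]
    intro n
    refine mem_pow_of_pow_mul_mem hreg 1 n ?_
    rw [pow_one, mul_comm, ha]
    exact zero_mem _
  rwa [Ideal.iInf_pow_eq_bot_of_isLocalRing _ (maximalIdeal.isMaximal A).ne_top] at h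

theorem length_fiberPiece [IsNoetherianRing A] (n : ℕ) :
    Module.length A (FiberPiece (maximalIdeal A) n) = mu A n := by
  have h : (maximalIdeal A * maximalIdeal A ^ n).submoduleOf (maximalIdeal A ^ n) =
      maximalIdeal A • (⊤ : Submodule A ↥(maximalIdeal A ^ n)) := by
    apply Submodule.map_injective_of_injective (maximalIdeal A ^ n).subtype_injective
    rw [Submodule.map_smul'', Submodule.map_top, Submodule.range_subtype, Submodule.submoduleOf,
      Submodule.map_comap_subtype, smul_eq_mul, inf_eq_right]
    exact Ideal.mul_le_inf.trans inf_le_right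
  have e := Submodule.quotEquivOfEq _ _ h
  let _ : Field (A ⧸ maximalIdeal A) := Ideal.Quotient.field _
  rw [mu, spanFinrank_eq_finrank_quotient _ (IsNoetherian.noetherian _),
    ← Module.length_eq_finrank]
  refine e.length_eq.trans ?_
  exact Module.length_eq_of_surjective Ideal.Quotient.mk_surjective

/-- The exact sequence `0 → G_i → G_j → 𝔪 ^ j / (x ^ (j - i) 𝔪 ^ i + 𝔪 ^ (j + 1)) → 0`. -/
theorem length_quotient_add_mu [IsNoetherianRing A] {x : A} (hx : x ∈ maximalIdeal A)
    (hreg : ∀ (n : ℕ) (a : A), a ∈ maximalIdeal A ^ n → x * a ∈ maximalIdeal A ^ (n + 2) →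
      a ∈ maximalIdeal A ^ (n + 1)) {i j : ℕ} (hij : i ≤ j)
    {N : Submodule A ↥(maximalIdeal A ^ j)}
    (hN : ∀ b, b ∈ N ↔ ∃ a ∈ maximalIdeal A ^ i,
      (b : A) - x ^ (j - i) * a ∈ maximalIdeal A ^ (j + 1)) :
    Module.length A (↥(maximalIdeal A ^ j) ⧸ N) + mu A i = mu A j := by
  obtain ⟨k, rfl⟩ := Nat.exists_eq_add_of_le' hij
  rw [Nat.add_sub_cancel] at hN
  have hmem : ∀ a ∈ maximalIdeal A ^ i, x ^ k * a ∈ maximalIdeal A ^ (k + i) := fun a ha => by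
    rw [pow_add]; exact Ideal.mul_mem_mul (Ideal.pow_mem_pow hx k) ha
  let f₀ : ↥(maximalIdeal A ^ i) →ₗ[A] FiberPiece (maximalIdeal A) (k + i) :=
    { toFun := fun a => FiberPiece.mk _ (k + i) ⟨x ^ k * a, hmem a a.2⟩
      map_add' := fun a b => by rw [← map_add]; congr 1; ext; simp [mul_add]
      map_smul' := fun c a => by
        rw [RingHom.id_apply, ← map_smul]; congr 1; ext; simp [mul_left_comm] }
  have hf₀ : ∀ a, f₀ a = 0 ↔ (a : A) ∈ maximalIdeal A * maximalIdeal A ^ i := by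
    intro a
    have h : f₀ a = FiberPiece.mk _ (k + i) ⟨x ^ k * a, hmem a a.2⟩ := rfl
    rw [h, FiberPiece.mk_eq_zero, ← pow_succ', ← pow_succ']
    refine ⟨fun h => mem_pow_of_pow_mul_mem hreg k (i + 1) (by convert h using 2; ring),
      fun h => ?_⟩
    rw [add_assoc, pow_add]
    exact Ideal.mul_mem_mul (Ideal.pow_mem_pow hx k) h
  let f := FiberPiece.lift f₀ fun a ha => (hf₀ a).2 ha
  have hle : ∀ b : ↥(maximalIdeal A ^ (k + i)),
      (b : A) ∈ maximalIdeal A * maximalIdeal A ^ (k + i) → N.mkQ b = 0 := by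
    intro b hb
    rw [Submodule.mkQ_apply, Submodule.Quotient.mk_eq_zero, hN]
    exact ⟨0, zero_mem _, by simpa [pow_succ'] using hb⟩
  have hinj : Function.Injective f := by
    rw [injective_iff_map_eq_zero]
    intro a ha
    obtain ⟨a, rfl⟩ := FiberPiece.mk_surjective _ _ a
    exact FiberPiece.mk_eq_zero.2 ((hf₀ a).1 ha)
  have hsurj : Function.Surjective (FiberPiece.lift N.mkQ hle) := by
    intro b
    obtain ⟨b, rfl⟩ := N.mkQ_surjective b
    exact ⟨FiberPiece.mk _ _ b, rfl⟩
  have hexact : Function.Exact f (FiberPiece.lift N.mkQ hle) := by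
    intro b
    obtain ⟨b, rfl⟩ := FiberPiece.mk_surjective _ _ b
    rw [FiberPiece.lift_mk, Submodule.mkQ_apply, Submodule.Quotient.mk_eq_zero, hN]
    constructor
    · rintro ⟨a, ha, hab⟩
      refine ⟨FiberPiece.mk _ _ ⟨a, ha⟩, Eq.symm ?_⟩
      change FiberPiece.mk _ _ _ = FiberPiece.mk _ _ _
      rw [← sub_eq_zero, ← map_sub, FiberPiece.mk_eq_zero, ← pow_succ']
      exact hab
    · rintro ⟨a, ha⟩
      obtain ⟨a, rfl⟩ := FiberPiece.mk_surjective _ _ a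
      change FiberPiece.mk _ _ _ = FiberPiece.mk _ _ _ at ha
      refine ⟨a, a.2, ?_⟩
      rw [← sub_eq_zero, ← neg_eq_zero, neg_sub, ← map_sub, FiberPiece.mk_eq_zero,
        ← pow_succ'] at ha
      exact ha
  rw [← length_fiberPiece, ← length_fiberPiece,
    Module.length_eq_add_of_exact f (FiberPiece.lift N.mkQ hle) hinj hsurj hexact, add_comm]

/-- The case `j = i + 1` of the exact sequence: since `𝔪^(i+1) ∩ xA = x𝔪^i`, its cokernel is the
Apery quotient. Stated as a sum because subtraction in `ℕ∞` is truncated. -/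
theorem aperyInvariant_add_mu [IsNoetherianRing A] {x : A} (hx : x ∈ maximalIdeal A)
    (hreg : ∀ (n : ℕ) (a : A), a ∈ maximalIdeal A ^ n → x * a ∈ maximalIdeal A ^ (n + 2) →
      a ∈ maximalIdeal A ^ (n + 1)) (i : ℕ) :
    aperyInvariant x (i + 1) + mu A i = mu A (i + 1) := by
  rw [aperyInvariant, quotLength_eq_of_linearMap (maximalIdeal A ^ (i + 1)).subtype]
  · refine length_quotient_add_mu hx hreg (Nat.le_succ i) fun b => ?_
    rw [Nat.succ_sub (le_refl i), Nat.sub_self, pow_one, Submodule.mem_comap]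
    constructor
    · intro hb
      obtain ⟨c, hc, y, hy, hcy⟩ := Submodule.mem_sup.1 hb
      obtain ⟨a, rfl⟩ := Ideal.mem_span_singleton'.1 hy
      have hca : c + a * x = b := hcy
      refine ⟨a, mem_pow_of_pow_mul_mem hreg 1 i ?_, ?_⟩
      · rw [pow_one, mul_comm, show a * x = b - c by rw [← hca]; ring]
        exact sub_mem b.2 (Ideal.pow_le_pow_right (by omega) hc)
      · rw [← hca]
        simpa [mul_comm] using hc
    · rintro ⟨a, -, hab⟩
      exact Submodule.mem_sup.2 ⟨_, hab, x * a,
        Ideal.mul_mem_right _ _ (Ideal.mem_span_singleton_self x), by simp⟩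
  · rw [Submodule.range_subtype, ← sup_assoc,
      sup_eq_left.2 (Ideal.pow_le_pow_right (Nat.le_succ (i + 1)) :
      maximalIdeal A ^ (i + 1 + 1) ≤ maximalIdeal A ^ (i + 1))]

end Lengths

/-! ### The first neighborhood ring as `𝔪^r / x^r`, and the layer lengths. -/

section Neighborhood

variable {A : Type*} [CommRing A] [IsLocalRing A]

theorem isSuperficial_pow_of_pow_succ_eq {x : A} {r : ℕ} (hx : x ∈ maximalIdeal A)
    (hr : maximalIdeal A ^ (r + 1) = Ideal.span {x} * maximalIdeal A ^ r) (n : ℕ) :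
    IsSuperficial n (x ^ n) := by
  refine ⟨Ideal.pow_mem_pow hx n, Filter.eventually_atTop.2 ⟨r, fun k hk => ?_⟩⟩
  obtain ⟨k, rfl⟩ := Nat.exists_eq_add_of_le' hk
  rw [add_right_comm, pow_add_eq_of_pow_succ_eq hr, pow_add_eq_of_pow_succ_eq hr, add_comm k n,
    pow_add, ← Ideal.span_singleton_mul_span_singleton, mul_assoc]

/-- The map `b ↦ b x ^ i / x ^ r` from `𝔪 ^ r` to the total ring of fractions. -/
def fractionMap (x : A⁰) (r i : ℕ) : ↥(maximalIdeal A ^ r) →ₗ[A] FractionRing A :=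
  (LinearMap.mulRight A (IsLocalization.mk' (FractionRing A) ((x : A) ^ i) (x ^ r))).comp
    ((Algebra.linearMap A (FractionRing A)).comp (maximalIdeal A ^ r).subtype)

theorem fractionMap_apply (x : A⁰) (r i : ℕ) (b : ↥(maximalIdeal A ^ r)) :
    fractionMap x r i b = IsLocalization.mk' (FractionRing A) ((b : A) * (x : A) ^ i) (x ^ r) := by
  rw [← IsLocalization.mul_mk'_eq_mk'_of_mul]
  rfl

/-- The single denominator `x^r` suffices: for large `n`, `x^(n+r) b ∈ 𝔪^(n+r+s) = a x^n 𝔪^r`, and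
cancelling `x^n` gives `x^r b = a d` with `d ∈ 𝔪^r`. -/
theorem mem_firstNeighborhood_iff {x : A⁰} {r : ℕ} (hx : (x : A) ∈ maximalIdeal A)
    (hr : maximalIdeal A ^ (r + 1) = Ideal.span {(x : A)} * maximalIdeal A ^ r)
    (z : FractionRing A) : z ∈ firstNeighborhood A ↔
      ∃ b ∈ maximalIdeal A ^ r, z = IsLocalization.mk' (FractionRing A) b (x ^ r) := by
  constructor
  · rintro ⟨s, b, a, hb, ha, rfl⟩
    obtain ⟨n, hn, hrn⟩ := (ha.2.and (Filter.eventually_ge_atTop r)).exists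
    obtain ⟨n, rfl⟩ := Nat.exists_eq_add_of_le' hrn
    have h1 : (x : A) ^ (n + r) * b ∈ maximalIdeal A ^ (n + r + s) := by
      rw [pow_add _ _ s]
      exact Ideal.mul_mem_mul (Ideal.pow_mem_pow hx _) hb
    rw [hn, pow_add_eq_of_pow_succ_eq hr] at h1
    obtain ⟨c, hc, hc'⟩ := Ideal.mem_span_singleton_mul.1 h1
    obtain ⟨d, hd, rfl⟩ := Ideal.mem_span_singleton_mul.1 hc
    refine ⟨d, hd, IsLocalization.mk'_eq_of_eq ?_⟩
    have hxn : (x : A) ^ n ∈ A⁰ := pow_mem x.2 n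
    refine (mul_cancel_left_mem_nonZeroDivisors hxn).1 ?_
    rw [SubmonoidClass.coe_pow]
    linear_combination hc'
  · rintro ⟨b, hb, rfl⟩
    exact ⟨r, b, x ^ r, hb, isSuperficial_pow_of_pow_succ_eq hx hr r, rfl⟩

theorem pow_smul_firstNeighborhood {x : A⁰} {r : ℕ} (hx : (x : A) ∈ maximalIdeal A)
    (hr : maximalIdeal A ^ (r + 1) = Ideal.span {(x : A)} * maximalIdeal A ^ r) (i : ℕ) :
    maximalIdeal A ^ i • Subalgebra.toSubmodule (firstNeighborhood A) =
      LinearMap.range (fractionMap x r i) := by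
  apply le_antisymm
  · rw [Submodule.smul_le]
    intro y hy z hz
    obtain ⟨b, hb, rfl⟩ := (mem_firstNeighborhood_iff hx hr z).1 hz
    have hyb : y * b ∈ maximalIdeal A ^ (i + r) := by
      rw [pow_add]; exact Ideal.mul_mem_mul hy hb
    rw [pow_add_eq_of_pow_succ_eq hr] at hyb
    obtain ⟨c, hc, hc'⟩ := Ideal.mem_span_singleton_mul.1 hyb
    refine ⟨⟨c, hc⟩, ?_⟩
    rw [fractionMap_apply, mul_comm, hc', ← IsLocalization.smul_mk']
  · rintro _ ⟨b, rfl⟩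
    rw [fractionMap_apply, mul_comm, ← IsLocalization.smul_mk']
    exact Submodule.smul_mem_smul (Ideal.pow_mem_pow hx i)
      ((mem_firstNeighborhood_iff hx hr _).2 ⟨b, b.2, rfl⟩)

/-- The case `j = r` of the exact sequence: `b ↦ b x^i / x^r` maps `𝔪^r` onto the quotient of
layers, and its kernel is `x^(r-i)𝔪^i + 𝔪^(r+1)`. -/
theorem layerLength_add_mu [IsNoetherianRing A] {x : A} {r : ℕ} (hx : x ∈ maximalIdeal A)
    (hr : maximalIdeal A ^ (r + 1) = Ideal.span {x} * maximalIdeal A ^ r)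
    (hreg : ∀ (n : ℕ) (a : A), a ∈ maximalIdeal A ^ n → x * a ∈ maximalIdeal A ^ (n + 2) →
      a ∈ maximalIdeal A ^ (n + 1)) {i : ℕ} (hi : i ≤ r) :
    layerLength A i + mu A i = mu A r := by
  obtain ⟨x, rfl⟩ : ∃ y : A⁰, (y : A) = x := ⟨⟨x, mem_nonZeroDivisors_of_regular hreg⟩, rfl⟩
  have hxi : ((x : A) ^ i) ∈ A⁰ := pow_mem x.2 i
  have hlayer : ∀ k, neighborhoodLayer A k = 1 ⊔ LinearMap.range (fractionMap x r k) := fun k => by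
    rw [neighborhoodLayer, pow_smul_firstNeighborhood hx hr]
  have hsucc : ∀ b : ↥(maximalIdeal A ^ r),
      fractionMap x r (i + 1) b = fractionMap x r i ((x : A) • b) := fun b => by
    rw [fractionMap_apply, fractionMap_apply]
    congr 1
    simp only [Submodule.coe_smul, smul_eq_mul]
    ring
  have hle : LinearMap.range (fractionMap x r (i + 1)) ≤ LinearMap.range (fractionMap x r i) := by
    rintro _ ⟨b, rfl⟩
    exact ⟨_, (hsucc b).symm⟩
  rw [layerLength, quotLength_eq_of_linearMap (fractionMap x r i)]
  · refine length_quotient_add_mu hx hreg hi fun b => ?_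
    rw [Submodule.mem_comap, hlayer, Submodule.mem_sup]
    obtain ⟨k, rfl⟩ := Nat.exists_eq_add_of_le' hi
    -- Clearing the denominator `x^(k+i)` and cancelling `x^i` turns membership in the next layer
    -- into an equation in `A`, where `x𝔪^r = 𝔪^(r+1)` can be used.
    have key : ∀ a c : A, (algebraMap A (FractionRing A) a +
        IsLocalization.mk' (FractionRing A) (c * (x : A) ^ (i + 1)) (x ^ (k + i)) =
          IsLocalization.mk' (FractionRing A) ((b : A) * (x : A) ^ i) (x ^ (k + i))) ↔
        (b : A) - (x : A) ^ k * a = x * c := by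
      intro a c
      rw [IsLocalization.eq_mk'_iff_mul_eq, add_mul, IsLocalization.mk'_spec, ← map_mul, ← map_add,
        (IsFractionRing.injective A (FractionRing A)).eq_iff, SubmonoidClass.coe_pow]
      refine ⟨fun h => (mul_cancel_left_mem_nonZeroDivisors hxi).1 ?_, fun h => ?_⟩
      · linear_combination -h
      · linear_combination -(x : A) ^ i * h
    rw [Nat.add_sub_cancel]
    constructor
    · rintro ⟨_, hy, _, ⟨c, rfl⟩, h⟩
      obtain ⟨a, rfl⟩ := Submodule.mem_one.1 hy
      rw [fractionMap_apply, fractionMap_apply, key] at h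
      have hmem : (b : A) - (x : A) ^ k * a ∈ maximalIdeal A ^ (k + i + 1) := by
        rw [h, pow_succ']
        exact Ideal.mul_mem_mul hx c.2
      refine ⟨a, mem_pow_of_pow_mul_mem hreg k i ?_, hmem⟩
      rw [add_comm i k, ← sub_sub_cancel (b : A) ((x : A) ^ k * a)]
      exact sub_mem b.2 (Ideal.pow_le_pow_right (Nat.le_succ _) hmem)
    · rintro ⟨a, -, hab⟩
      rw [hr] at hab
      obtain ⟨c, hc, hc'⟩ := Ideal.mem_span_singleton_mul.1 hab
      refine ⟨algebraMap _ _ a, Submodule.mem_one.2 ⟨a, rfl⟩, _, ⟨⟨c, hc⟩, rfl⟩, ?_⟩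
      rw [fractionMap_apply, fractionMap_apply, key]
      exact hc'.symm
  · rw [hlayer, hlayer, sup_left_comm, sup_eq_left.2 hle]

end Neighborhood

/-! ### Multiplication by the initial form, degree by degree. -/

section InitialForm

theorem mul_mem_pow_succ {R : Type*} [CommRing R] {J : Ideal R} {x : R} (hx : x ∈ J) {n : ℕ}
    {a : R} (ha : a ∈ J ^ n) : x * a ∈ J ^ (n + 1) := by
  rw [pow_succ']; exact Ideal.mul_mem_mul hx ha

variable {A : Type*} [CommRing A] [IsLocalRing A] {J : Ideal A} {x : A}

/-- The class of `x ∈ J` in degree one of the fiber cone. -/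
def initialForm (hx : x ∈ J) : FiberCone J :=
  DirectSum.of (FiberPiece J) 1 (FiberPiece.mk J 1 ⟨x, by rwa [pow_one]⟩)

theorem xStar_eq_initialForm (x : A) :
    xStar x = initialForm (Ideal.mem_span_singleton_self x) :=
  rfl

theorem fiberConeMap_xStar (hx : Ideal.span {x} ≤ J) :
    fiberConeMap hx (xStar x) = initialForm (hx (Ideal.mem_span_singleton_self x)) :=
  fiberConeMap_of _ _ _

/-- Multiplication of representatives by `x`, with values in the graded piece. -/
def FiberPiece.preShift (hx : x ∈ J) (n : ℕ) : ↥(J ^ n) →ₗ[A] FiberPiece J (n + 1) where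
  toFun a := FiberPiece.mk J (n + 1) ⟨x * a, mul_mem_pow_succ hx a.2⟩
  map_add' a b := by rw [← map_add]; congr 1; ext; simp [mul_add]
  map_smul' c a := by rw [RingHom.id_apply, ← map_smul]; congr 1; ext; simp [mul_left_comm]

theorem FiberPiece.preShift_apply (hx : x ∈ J) (n : ℕ) (a : ↥(J ^ n)) :
    FiberPiece.preShift hx n a = FiberPiece.mk J (n + 1) ⟨x * a, mul_mem_pow_succ hx a.2⟩ :=
  rfl

theorem FiberPiece.preShift_eq_zero (hx : x ∈ J) (n : ℕ) (a : ↥(J ^ n))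
    (ha : (a : A) ∈ maximalIdeal A * J ^ n) : FiberPiece.preShift hx n a = 0 := by
  rw [FiberPiece.preShift_apply, FiberPiece.mk_eq_zero]
  dsimp only
  rw [pow_succ', mul_left_comm]
  exact Ideal.mul_mem_mul hx ha

/-- Multiplication by the initial form of `x` on the component of degree `n`. -/
def FiberPiece.shift (hx : x ∈ J) (n : ℕ) : FiberPiece J n →ₗ[A] FiberPiece J (n + 1) :=
  FiberPiece.lift (FiberPiece.preShift hx n) (FiberPiece.preShift_eq_zero hx n)

theorem FiberPiece.shift_mk (hx : x ∈ J) (n : ℕ) (a : ↥(J ^ n)) :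
    FiberPiece.shift hx n (FiberPiece.mk J n a) =
      FiberPiece.mk J (n + 1) ⟨x * a, mul_mem_pow_succ hx a.2⟩ :=
  rfl

theorem initialForm_mul_of (hx : x ∈ J) (n : ℕ) (z : FiberPiece J n) :
    initialForm hx * DirectSum.of (FiberPiece J) n z =
      DirectSum.of (FiberPiece J) (n + 1) (FiberPiece.shift hx n z) := by
  obtain ⟨a, rfl⟩ := FiberPiece.mk_surjective J n z
  rw [initialForm, of_mk_mul_of_mk, FiberPiece.shift_mk]
  exact of_mk_congr (add_comm 1 n) _ _ rfl

theorem initialForm_mul_apply_zero (hx : x ∈ J) (f : FiberCone J) :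
    (initialForm hx * f) 0 = 0 := by
  induction f using DirectSum.induction_on with
  | zero => simp
  | of n z => rw [initialForm_mul_of, DirectSum.of_eq_of_ne _ _ _ (by omega)]
  | add f g hf hg => rw [mul_add, DirectSum.add_apply, hf, hg, add_zero]

theorem initialForm_mul_apply_succ (hx : x ∈ J) (f : FiberCone J) (n : ℕ) :
    (initialForm hx * f) (n + 1) = FiberPiece.shift hx n (f n) := by
  induction f using DirectSum.induction_on with
  | zero => simp
  | of k z =>
    rw [initialForm_mul_of]
    by_cases h : k = n
    · subst h
      rw [DirectSum.of_eq_same, DirectSum.of_eq_same]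
    · rw [DirectSum.of_eq_of_ne _ _ _ (by omega), DirectSum.of_eq_of_ne _ _ _ (by omega), map_zero]
  | add f g hf hg => rw [mul_add, DirectSum.add_apply, DirectSum.add_apply, hf, hg, map_add]

theorem initialForm_mul_eq_zero {hx : x ∈ J}
    (hinj : ∀ n, Function.Injective (FiberPiece.shift hx n)) {f : FiberCone J}
    (h : initialForm hx * f = 0) : f = 0 := by
  refine DFinsupp.ext fun n => hinj n ?_
  rw [DirectSum.zero_apply, map_zero]
  refine (initialForm_mul_apply_succ hx f n).symm.trans ?_
  rw [h, DirectSum.zero_apply]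

theorem initialForm_pow_mul_eq_zero {hx : x ∈ J}
    (hinj : ∀ n, Function.Injective (FiberPiece.shift hx n)) (j : ℕ) {f : FiberCone J}
    (h : initialForm hx ^ j * f = 0) : f = 0 := by
  induction j with
  | zero => simpa using h
  | succ j ih => exact ih (initialForm_mul_eq_zero hinj (by rwa [← mul_assoc, ← pow_succ']))

theorem shift_injective {hx : x ∈ maximalIdeal A}
    (hreg : ∀ (n : ℕ) (a : A), a ∈ maximalIdeal A ^ n → x * a ∈ maximalIdeal A ^ (n + 2) →
      a ∈ maximalIdeal A ^ (n + 1)) (n : ℕ) : Function.Injective (FiberPiece.shift hx n) := by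
  rw [injective_iff_map_eq_zero]
  intro z hz
  obtain ⟨a, rfl⟩ := FiberPiece.mk_surjective _ n z
  rw [FiberPiece.shift_mk, FiberPiece.mk_eq_zero, ← pow_succ'] at hz
  rw [FiberPiece.mk_eq_zero, ← pow_succ']
  exact hreg n a a.2 hz

theorem smul_one_eq (c : A) : c • (1 : FiberCone J) =
    DirectSum.of (FiberPiece J) 0 (FiberPiece.mk J 0 ⟨c, by simp⟩) := by
  rw [smul_eq_of_zero_mul, mul_one]

theorem smul_fiberCone_eq_zero {c : A} (hc : c ∈ maximalIdeal A) (f : FiberCone J) :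
    c • f = 0 :=
  DFinsupp.ext fun n => FiberPiece.smul_eq_zero hc (f n)

theorem fiberConeMap_smul {K : Ideal A} (h : J ≤ K) (c : A) (f : FiberCone J) :
    fiberConeMap h (c • f) = c • fiberConeMap h f := by
  rw [smul_eq_of_zero_mul, smul_eq_of_zero_mul, map_mul, fiberConeMap_of]
  rfl

theorem smul_mul_fiberCone (c : A) (f g : FiberCone J) : c • f * g = c • (f * g) := by
  rw [smul_eq_of_zero_mul, smul_eq_of_zero_mul c (f * g), mul_assoc]

theorem exists_eq_smul_one_add_xStar_mul (f : NoetherNormalization x) :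
    ∃ (c : A) (f' : NoetherNormalization x), f = c • 1 + xStar x * f' := by
  induction f using fiberCone_induction with
  | zero => exact ⟨0, 0, by simp⟩
  | of_mk n a =>
    cases n with
    | zero => exact ⟨a, 0, by rw [mul_zero, add_zero, smul_one_eq]⟩
    | succ n =>
      obtain ⟨a, ha⟩ := a
      have ha' := ha
      rw [pow_succ', Ideal.mem_span_singleton_mul] at ha'
      obtain ⟨b, hb, rfl⟩ := ha'
      refine ⟨0, DirectSum.of _ n (FiberPiece.mk _ n ⟨b, hb⟩), ?_⟩
      rw [zero_smul, zero_add]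
      rw [xStar_eq_initialForm, initialForm_mul_of, FiberPiece.shift_mk]
  | add f g hf hg =>
    obtain ⟨c, f', rfl⟩ := hf
    obtain ⟨d, g', rfl⟩ := hg
    exact ⟨c + d, f' + g', by rw [add_smul, mul_add]; abel⟩

theorem xStar_mul_mem_shiftedDegreePart {i d : ℕ} {f : NoetherNormalization x}
    (hf : f ∈ shiftedDegreePart x i d) : xStar x * f ∈ shiftedDegreePart x i (d + 1) := by
  unfold shiftedDegreePart at hf ⊢
  split_ifs at hf with h
  · obtain ⟨z, rfl⟩ := hf
    rw [if_pos (by omega), Nat.succ_sub h]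
    exact ⟨_, (initialForm_mul_of (Ideal.mem_span_singleton_self x) _ z).symm⟩
  · rw [AddSubgroup.mem_bot.1 hf, mul_zero]
    exact zero_mem _

/-- Since `x^n` is a nonzerodivisor, `x^n A / x^n 𝔪` is a copy of the residue field. -/
theorem length_fiberPiece_span_singleton (hx : x ∈ A⁰) (n : ℕ) :
    Module.length A (FiberPiece (Ideal.span {x}) n) = 1 := by
  let g : A →ₗ[A] FiberPiece (Ideal.span {x}) n := LinearMap.toSpanSingleton A _
    (FiberPiece.mk _ n ⟨x ^ n, Ideal.pow_mem_pow (Ideal.mem_span_singleton_self x) n⟩)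
  have hg : ∀ a, g a = FiberPiece.mk _ n ⟨a * x ^ n, Ideal.mul_mem_left _ _
      (Ideal.pow_mem_pow (Ideal.mem_span_singleton_self x) n)⟩ := fun a => rfl
  have hker : LinearMap.ker g = maximalIdeal A := by
    ext a
    rw [LinearMap.mem_ker, hg, FiberPiece.mk_eq_zero]
    dsimp only
    rw [Ideal.span_singleton_pow, mul_comm (maximalIdeal A), Ideal.mem_span_singleton_mul]
    constructor
    · rintro ⟨b, hb, h⟩
      rw [mul_comm] at h
      rwa [← (mul_cancel_right_mem_nonZeroDivisors (pow_mem hx n)).1 h]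
    · exact fun ha => ⟨a, ha, mul_comm _ _⟩
  have hsurj : Function.Surjective g := by
    intro z
    obtain ⟨⟨a, ha⟩, rfl⟩ := FiberPiece.mk_surjective _ n z
    have ha' := ha
    rw [Ideal.span_singleton_pow, Ideal.mem_span_singleton'] at ha'
    obtain ⟨b, rfl⟩ := ha'
    exact ⟨b, hg b⟩
  rw [Module.length_eq_one_iff, isSimpleModule_iff_quot_maximal]
  exact ⟨maximalIdeal A, maximalIdeal.isMaximal A,
    ⟨((Submodule.quotEquivOfEq _ _ hker.symm).trans (g.quotKerEquivOfSurjective hsurj)).symm⟩⟩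

end InitialForm

/-! ### Existence of a decomposition: a homogeneous basis over `F(x)`. -/

section Existence

variable {A : Type*} [CommRing A] [IsLocalRing A] {x : A}

/-- Lifts a basis of `M / N` over the residue field, phrased with coefficients in `A`. Applied with
`M = G_d` and `N = x*G_{d-1}`, it selects the new generators in degree `d`. -/
theorem exists_residue_basis {M : Type*} [AddCommGroup M] [Module A M] [Module.Finite A M]
    (hM : ∀ c ∈ maximalIdeal A, ∀ z : M, c • z = 0) (N : Submodule A M) :
    ∃ (n : ℕ) (b : Fin n → M), (∀ z, ∃ c : Fin n → A, z - ∑ l, c l • b l ∈ N) ∧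
      ∀ c : Fin n → A, ∑ l, c l • b l ∈ N → ∀ l, c l ∈ maximalIdeal A := by
  have hT : Module.IsTorsionBySet A (M ⧸ N) (maximalIdeal A : Set A) := by
    rintro z ⟨c, hc⟩
    obtain ⟨z, rfl⟩ := N.mkQ_surjective z
    change c • N.mkQ z = 0
    rw [← map_smul, hM c hc, map_zero]
  let _ : Field (A ⧸ maximalIdeal A) := Ideal.Quotient.field _
  let _ : Module (A ⧸ maximalIdeal A) (M ⧸ N) := hT.module
  have hsmul : ∀ (c : A) (z : M ⧸ N), Ideal.Quotient.mk (maximalIdeal A) c • z = c • z :=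
    fun _ _ => rfl
  have : IsScalarTower A (A ⧸ maximalIdeal A) (M ⧸ N) := hT.isScalarTower
  have : Module.Finite (A ⧸ maximalIdeal A) (M ⧸ N) := Module.Finite.of_restrictScalars_finite A _ _
  let B := Module.finBasis (A ⧸ maximalIdeal A) (M ⧸ N)
  choose b hb using fun l => N.mkQ_surjective (B l)
  have hsum : ∀ c : Fin _ → A, N.mkQ (∑ l, c l • b l) =
      ∑ l, Ideal.Quotient.mk (maximalIdeal A) (c l) • B l := fun c => by
    rw [map_sum]
    exact Finset.sum_congr rfl fun l _ => by rw [map_smul, hb, hsmul]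
  refine ⟨_, b, fun z => ?_, fun c hc l => ?_⟩
  · choose c hc using fun l => Ideal.Quotient.mk_surjective (B.repr (N.mkQ z) l)
    refine ⟨c, ?_⟩
    rw [← Submodule.Quotient.mk_eq_zero, ← Submodule.mkQ_apply, map_sub, hsum]
    simp_rw [hc]
    rw [B.sum_repr, sub_self]
  · rw [← Submodule.Quotient.mk_eq_zero, ← Submodule.mkQ_apply, hsum] at hc
    exact Ideal.Quotient.eq_zero_iff_mem.1
      (Fintype.linearIndependent_iff.1 B.linearIndependent _ hc l)

/-- The image of multiplication by the initial form of `x` in degree `d`. -/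
def shiftRange {J : Ideal A} (hx : x ∈ J) : ∀ d : ℕ, Submodule A (FiberPiece J d)
  | 0 => ⊥
  | d + 1 => LinearMap.range (FiberPiece.shift hx d)

theorem initialForm_mul_apply_mem {J : Ideal A} (hx : x ∈ J) (f : FiberCone J) (d : ℕ) :
    (initialForm hx * f) d ∈ shiftRange hx d := by
  cases d with
  | zero => rw [initialForm_mul_apply_zero]; exact zero_mem _
  | succ d => rw [initialForm_mul_apply_succ]; exact LinearMap.mem_range_self _ _

theorem shiftRange_eq_top_of_lt {r : ℕ} (hx : x ∈ maximalIdeal A)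
    (hr : maximalIdeal A ^ (r + 1) = Ideal.span {x} * maximalIdeal A ^ r) {d : ℕ} (hd : r < d) :
    shiftRange hx d = ⊤ := by
  obtain ⟨k, rfl⟩ : ∃ k, d = k + r + 1 := ⟨d - r - 1, by omega⟩
  refine LinearMap.range_eq_top.2 fun z => ?_
  obtain ⟨⟨a, ha⟩, rfl⟩ := FiberPiece.mk_surjective _ _ z
  have ha' := ha
  rw [add_right_comm, pow_add_eq_of_pow_succ_eq hr, pow_succ',
    ← Ideal.span_singleton_mul_span_singleton, mul_assoc, ← pow_add_eq_of_pow_succ_eq hr,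
    Ideal.mem_span_singleton_mul] at ha'
  obtain ⟨b, hb, rfl⟩ := ha'
  exact ⟨FiberPiece.mk _ _ ⟨b, hb⟩, rfl⟩

/-- The `F(x)`-linear map from a free module to the tangent cone given by homogeneous elements. -/
def freeMap {ι : Type*} [Fintype ι] (hx : Ideal.span {x} ≤ maximalIdeal A) (deg : ι → ℕ)
    (b : ∀ k, FiberPiece (maximalIdeal A) (deg k)) :
    (ι → NoetherNormalization x) →+ TangentCone A where
  toFun f := ∑ k, fiberConeMap hx (f k) * DirectSum.of _ (deg k) (b k)
  map_zero' := by simp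
  map_add' f g := by
    simp only [Pi.add_apply, map_add, add_mul, Finset.sum_add_distrib]

section FreeMap

variable {ι : Type*} [Fintype ι] (hx : Ideal.span {x} ≤ maximalIdeal A) (deg : ι → ℕ)
  (b : ∀ k, FiberPiece (maximalIdeal A) (deg k))

theorem freeMap_apply (f : ι → NoetherNormalization x) :
    freeMap hx deg b f = ∑ k, fiberConeMap hx (f k) * DirectSum.of _ (deg k) (b k) :=
  rfl

theorem freeMap_smul (g : NoetherNormalization x) (f : ι → NoetherNormalization x) :
    freeMap hx deg b (g • f) = fiberConeMap hx g * freeMap hx deg b f := by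
  simp only [freeMap_apply, Pi.smul_apply, smul_eq_mul, map_mul, mul_assoc, Finset.mul_sum]

theorem fiberConeMap_mul_of_mem {i d : ℕ} {g : NoetherNormalization x}
    (hg : g ∈ shiftedDegreePart x i d) (z : FiberPiece (maximalIdeal A) i) :
    fiberConeMap hx g * DirectSum.of _ i z ∈ degreePart (maximalIdeal A) d := by
  unfold shiftedDegreePart at hg
  split_ifs at hg with h
  · obtain ⟨w, rfl⟩ := hg
    have hd : ∀ n (y : FiberPiece (maximalIdeal A) n), n = d →
        DirectSum.of (FiberPiece (maximalIdeal A)) n y ∈ degreePart (maximalIdeal A) d := by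
      rintro _ y rfl
      exact ⟨y, rfl⟩
    rw [fiberConeMap_of, DirectSum.of_mul_of]
    exact hd _ _ (Nat.sub_add_cancel h)
  · rw [AddSubgroup.mem_bot.1 hg, map_zero, zero_mul]
    exact zero_mem _

theorem freeMap_mem_degreePart {d : ℕ} {f : ι → NoetherNormalization x}
    (hf : ∀ k, f k ∈ shiftedDegreePart x (deg k) d) :
    freeMap hx deg b f ∈ degreePart (maximalIdeal A) d :=
  sum_mem fun k _ => fiberConeMap_mul_of_mem hx (hf k) (b k)

/-- Modulo `x*` a relation has constant coefficients, which `hind` forces into `𝔪`; so `f` is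
divisible by `x*`. Cancelling `x*` gives another relation, so the process repeats and the components
of `f` vanish degree by degree. -/
theorem freeMap_injective
    (hinj : ∀ n, Function.Injective (FiberPiece.shift (hx (Ideal.mem_span_singleton_self x)) n))
    (hind : ∀ (d : ℕ) (c : ι → A),
      (∑ k, c k • (DirectSum.of (FiberPiece (maximalIdeal A)) (deg k) (b k) : TangentCone A)) d ∈
        shiftRange (hx (Ideal.mem_span_singleton_self x)) d →
      ∀ k, deg k = d → c k ∈ maximalIdeal A) :
    Function.Injective (freeMap hx deg b) := by
  rw [injective_iff_map_eq_zero]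
  suffices h : ∀ (n : ℕ) (f : ι → NoetherNormalization x), freeMap hx deg b f = 0 →
      ∀ k, f k n = 0 from fun f hf => funext fun k => DFinsupp.ext fun n => h n f hf k
  have key : ∀ f : ι → NoetherNormalization x, freeMap hx deg b f = 0 →
      ∃ f' : ι → NoetherNormalization x, f = xStar x • f' ∧ freeMap hx deg b f' = 0 := by
    intro f hf
    choose c f' hc using fun k => exists_eq_smul_one_add_xStar_mul (f k)
    have hsplit : freeMap hx deg b f =
        ∑ k, c k • (DirectSum.of (FiberPiece (maximalIdeal A)) (deg k) (b k) : TangentCone A) +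
        initialForm (hx (Ideal.mem_span_singleton_self x)) * freeMap hx deg b f' := by
      rw [← fiberConeMap_xStar, ← freeMap_smul, freeMap_apply, freeMap_apply,
        ← Finset.sum_add_distrib]
      refine Finset.sum_congr rfl fun k _ => ?_
      rw [hc k, map_add, add_mul, fiberConeMap_smul, map_one, smul_mul_fiberCone, one_mul]
      rfl
    have hcm : ∀ k, c k ∈ maximalIdeal A := by
      intro k
      refine hind (deg k) c ?_ k rfl
      rw [hf, eq_comm, ← eq_neg_iff_add_eq_zero, ← mul_neg] at hsplit
      rw [hsplit]
      exact initialForm_mul_apply_mem _ _ _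
    have hff' : f = xStar x • f' := funext fun k => by
      rw [hc k, smul_fiberCone_eq_zero (hcm k), zero_add]
      rfl
    refine ⟨f', hff', ?_⟩
    rw [hff', freeMap_smul, fiberConeMap_xStar] at hf
    exact initialForm_mul_eq_zero hinj hf
  intro n
  induction n with
  | zero =>
    intro f hf k
    obtain ⟨f', rfl, -⟩ := key f hf
    exact initialForm_mul_apply_zero (Ideal.mem_span_singleton_self x) (f' k)
  | succ n ih =>
    intro f hf k
    obtain ⟨f', rfl, hf'⟩ := key f hf
    refine (initialForm_mul_apply_succ (Ideal.mem_span_singleton_self x) (f' k) n).trans ?_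
    rw [ih f' hf' k, map_zero]

theorem exists_freeMap_eq_of
    (hspan : ∀ (d : ℕ) (z : FiberPiece (maximalIdeal A) d), ∃ c : ι → A,
      (∀ k, deg k ≠ d → c k = 0) ∧ ∃ w ∈ shiftRange (hx (Ideal.mem_span_singleton_self x)) d,
      (DirectSum.of _ d z : TangentCone A) =
        ∑ k, c k • DirectSum.of _ (deg k) (b k) + DirectSum.of _ d w)
    (d : ℕ) (z : FiberPiece (maximalIdeal A) d) :
    ∃ f : ι → NoetherNormalization x, (∀ k, f k ∈ shiftedDegreePart x (deg k) d) ∧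
      freeMap hx deg b f = DirectSum.of _ d z := by
  obtain ⟨c, hc, w, hw, hz⟩ := hspan d z
  have hmem : ∀ k, c k • (1 : NoetherNormalization x) ∈ shiftedDegreePart x (deg k) d := by
    intro k
    by_cases hk : deg k = d
    · rw [shiftedDegreePart, if_pos hk.le, hk, Nat.sub_self, smul_one_eq]
      exact ⟨_, rfl⟩
    · rw [hc k hk, zero_smul]
      exact zero_mem _
  have hsum : freeMap hx deg b (fun k => c k • 1) = ∑ k, c k • DirectSum.of _ (deg k) (b k) := by
    rw [freeMap_apply]
    exact Finset.sum_congr rfl fun k _ => by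
      rw [fiberConeMap_smul, map_one, smul_mul_fiberCone, one_mul]
  cases d with
  | zero =>
    refine ⟨_, hmem, ?_⟩
    rw [hz, hsum, (Submodule.mem_bot A).1 hw, map_zero, add_zero]
  | succ d =>
    -- The remainder is `x*` times an element of degree `d`, to which the recursion applies.
    obtain ⟨w, rfl⟩ := hw
    obtain ⟨f, hf, hfw⟩ := exists_freeMap_eq_of hspan d w
    refine ⟨(fun k => c k • 1) + xStar x • f,
      fun k => add_mem (hmem k) (xStar_mul_mem_shiftedDegreePart (hf k)), ?_⟩
    rw [map_add, freeMap_smul, hfw, hsum, hz, fiberConeMap_xStar, initialForm_mul_of]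

end FreeMap

theorem exists_isTangentConeInvariants [IsNoetherianRing A]
    (hx : IsReduction (Ideal.span {x}) (maximalIdeal A))
    (hreg : ∀ (n : ℕ) (a : A), a ∈ maximalIdeal A ^ n → x * a ∈ maximalIdeal A ^ (n + 2) →
      a ∈ maximalIdeal A ^ (n + 1)) :
    ∃ (α : ℕ → ℕ) (τ : ℕ → ℕ → ℕ), IsTangentConeInvariants x hx.1 α τ := by
  have hxm : x ∈ maximalIdeal A := hx.1 (Ideal.mem_span_singleton_self x)
  have hfin : ∀ d, Module.Finite A (FiberPiece (maximalIdeal A) d) := fun d =>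
    Module.Finite.of_surjective (FiberPiece.mk _ d) (FiberPiece.mk_surjective _ d)
  choose α b hspan hind using fun d => exists_residue_basis
    (fun c hc (z : FiberPiece (maximalIdeal A) d) => FiberPiece.smul_eq_zero hc z)
    (shiftRange hxm d)
  set r := reductionNumber x
  let deg : FreeIndex r α → ℕ := fun k => k.1
  let b' : ∀ k : FreeIndex r α, FiberPiece (maximalIdeal A) (deg k) := fun k => b k.1 k.2
  have hsum : ∀ (d : ℕ) (hd : d ∈ Finset.Icc 0 r) (c : FreeIndex r α → A),
      (∑ k, c k • (DirectSum.of (FiberPiece (maximalIdeal A)) (deg k) (b' k) : TangentCone A)) d =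
        ∑ l, c ⟨⟨d, hd⟩, l⟩ • b d l := by
    intro d hd c
    change DirectSum.component A ℕ _ d (∑ k, c k • DirectSum.lof A ℕ _ (deg k) (b' k)) = _
    rw [map_sum, Fintype.sum_sigma, Finset.sum_eq_single ⟨d, hd⟩]
    · exact Finset.sum_congr rfl fun l _ => by rw [map_smul, DirectSum.component.lof_self]
    · intro i _ hi
      refine Finset.sum_eq_zero fun l _ => ?_
      rw [map_smul]
      refine (congrArg _ (DirectSum.of_eq_of_ne _ _ _ fun h => hi (Subtype.ext h.symm))).trans ?_
      exact smul_zero _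
    · exact fun h => absurd (Finset.mem_univ _) h
  have hinj := freeMap_injective hx.1 deg b' (shift_injective hreg) (by
    rintro d c hc ⟨⟨d, hd⟩, l⟩ rfl
    rw [hsum _ hd] at hc
    exact hind d _ hc l)
  have hgr := exists_freeMap_eq_of hx.1 deg b' (by
    intro d z
    rcases lt_or_ge r d with hd | hd
    · refine ⟨0, fun _ _ => rfl, z, ?_, by simp⟩
      rw [shiftRange_eq_top_of_lt hxm (reductionNumber_spec hx) hd]
      trivial
    · have hd' : d ∈ Finset.Icc 0 r := Finset.mem_Icc.2 ⟨Nat.zero_le _, hd⟩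
      choose c hc using hspan
      -- Coefficients are read off the component of `of d z` in degree `k.1`, which avoids
      -- transporting `z` along `deg k = d`.
      refine ⟨fun k => if deg k = d then
          c k.1 ((DirectSum.of _ d z : TangentCone A) k.1) k.2 else 0,
        fun k hk => if_neg hk, _, hc d z, ?_⟩
      rw [Fintype.sum_sigma, Finset.sum_eq_single ⟨d, hd'⟩]
      · simp only [deg, b', if_true, DirectSum.of_eq_same]
        rw [map_sub, eq_comm, ← eq_sub_iff_add_eq, sub_sub_cancel]
        change _ = DirectSum.lof A ℕ _ d _
        rw [map_sum]
        exact Finset.sum_congr rfl fun l _ => (map_smul (DirectSum.lof A ℕ _ d) _ _).symm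
      · intro i _ hi
        refine Finset.sum_eq_zero fun l _ => ?_
        dsimp only
        rw [if_neg fun h => hi (Subtype.ext h), zero_smul]
      · exact fun h => absurd (Finset.mem_univ _) h)
  have hsurj : Function.Surjective (freeMap hx.1 deg b') := by
    intro g
    induction g using DirectSum.induction_on with
    | zero => exact ⟨0, map_zero _⟩
    | of d z => exact (hgr d z).imp fun f hf => hf.2
    | add g h hg hh =>
      obtain ⟨f, rfl⟩ := hg
      obtain ⟨f', rfl⟩ := hh
      exact ⟨f + f', map_add _ _ _⟩
  let E := AddEquiv.ofBijective (freeMap hx.1 deg b') ⟨hinj, hsurj⟩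
  have hE : ∀ f, E f = freeMap hx.1 deg b' f := fun _ => rfl
  -- The module is free, so zero torsion multiplicities suffice.
  have hempty : IsEmpty (TorsionIndex r fun _ _ => 0) := ⟨fun k => k.2.2.elim0⟩
  refine ⟨α, fun _ _ => 0, E.symm.trans (AddEquiv.prodUnique (M := _) (N := _)).symm, ?_, ?_⟩
  · intro f g
    refine Prod.ext ?_ (Subsingleton.elim _ _)
    change E.symm (fiberConeMap hx.1 f * g) = f • E.symm g
    rw [AddEquiv.symm_apply_eq, hE, freeMap_smul, ← hE, AddEquiv.apply_symm_apply]
  · intro d g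
    obtain ⟨f, rfl⟩ := E.surjective g
    have h1 : ((E.symm.trans (AddEquiv.prodUnique (N := (k : TorsionIndex r fun _ _ => 0) →
      TorsionQuotient x k.2.1)).symm) (E f)).1 = f := E.symm_apply_apply f
    rw [h1]
    constructor
    · rintro ⟨z, hz⟩
      obtain ⟨f', hf', hfz⟩ := hgr d z
      rw [hE, ← hfz] at hz
      rw [← hinj hz]
      exact ⟨hf', fun k => hempty.elim k⟩
    · rintro ⟨h, -⟩
      exact freeMap_mem_degreePart hx.1 deg b' h

end Existence

/-! ### The multiplicities of an arbitrary decomposition, and positivity. -/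

section Uniqueness

variable {A : Type*} [CommRing A] [IsLocalRing A] {x : A}

theorem nontrivial_torsionQuotient (x : A) {j : ℕ} (hj : j ≠ 0) :
    Nontrivial (TorsionQuotient x j) := by
  refine Ideal.Quotient.nontrivial_iff.2 fun h => ?_
  obtain ⟨f, hf⟩ := Ideal.mem_span_singleton'.1 ((Ideal.eq_top_iff_one _).1 h)
  have h0 : augmentation (Ideal.span {x}) (xStar x) = 0 :=
    (augmentation_of_mk _ _ _).trans (if_neg one_ne_zero)
  have h1 := congrArg (augmentation (Ideal.span {x})) hf
  rw [map_mul, map_pow, h0, zero_pow hj, mul_zero, map_one] at h1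
  exact zero_ne_one h1

/-- The generator of a torsion summand is nonzero and killed by `(x*)^j`, whereas `x*` is a
nonzerodivisor on the tangent cone. -/
theorem isEmpty_torsionIndex {hx : Ideal.span {x} ≤ maximalIdeal A}
    (hinj : ∀ n, Function.Injective (FiberPiece.shift (hx (Ideal.mem_span_singleton_self x)) n))
    {α : ℕ → ℕ} {τ : ℕ → ℕ → ℕ} (h : IsTangentConeInvariants x hx α τ) :
    IsEmpty (TorsionIndex (reductionNumber x) τ) := by
  classical
  obtain ⟨e, he, -⟩ := h
  refine ⟨fun k => ?_⟩
  have hj : (k.2.1 : ℕ) ≠ 0 := by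
    have := (Finset.mem_Icc.1 k.2.1.2).1
    omega
  have := nontrivial_torsionQuotient x hj
  set t : (FreeIndex (reductionNumber x) α → NoetherNormalization x) ×
    ((k : TorsionIndex (reductionNumber x) τ) → TorsionQuotient x k.2.1) :=
    (0, Pi.single k 1) with ht
  have h1 : e (fiberConeMap hx (xStar x ^ (k.2.1 : ℕ)) * e.symm t) = 0 := by
    have hz : xStar x ^ (k.2.1 : ℕ) • (1 : TorsionQuotient x k.2.1) = 0 := by
      change Ideal.Quotient.mk (Ideal.span {xStar x ^ (k.2.1 : ℕ)}) (_ * 1) = 0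
      rw [mul_one]
      exact Ideal.Quotient.eq_zero_iff_mem.2 (Ideal.mem_span_singleton_self _)
    rw [he, AddEquiv.apply_symm_apply, ht, Prod.smul_mk, smul_zero, ← Pi.single_smul, hz,
      Pi.single_zero, Prod.mk_zero_zero]
  rw [map_eq_zero_iff _ e.injective, map_pow, fiberConeMap_xStar] at h1
  have h2 := initialForm_pow_mul_eq_zero hinj _ h1
  rw [map_eq_zero_iff _ e.symm.injective] at h2
  have h3 := congrFun (congrArg Prod.snd h2) k
  rw [ht] at h3
  simp at h3

theorem mem_degreePart_iff {J : Ideal A} {d : ℕ} {f : FiberCone J} :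
    f ∈ degreePart J d ↔ DirectSum.of _ d (f d) = f := by
  refine ⟨?_, fun h => ⟨_, h⟩⟩
  rintro ⟨z, rfl⟩
  rw [DirectSum.of_eq_same]

/-- Compare lengths in degree `d`: each summand `F(x)(-i)` contributes one if `i ≤ d` and nothing
otherwise, and there is no torsion. -/
theorem mu_eq_card [IsNoetherianRing A] {hx : Ideal.span {x} ≤ maximalIdeal A} (hx0 : x ∈ A⁰)
    (hinj : ∀ n, Function.Injective (FiberPiece.shift (hx (Ideal.mem_span_singleton_self x)) n))
    {α : ℕ → ℕ} {τ : ℕ → ℕ → ℕ} (h : IsTangentConeInvariants x hx α τ) (d : ℕ) :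
    mu A d = Fintype.card {k : FreeIndex (reductionNumber x) α // (k.1 : ℕ) ≤ d} := by
  have hempty := isEmpty_torsionIndex hinj h
  obtain ⟨e, he, hdeg⟩ := h
  have hsmul : ∀ (c : A) (g : TangentCone A) k, (e (c • g)).1 k = c • (e g).1 k := fun c g k => by
    have h1 := congrArg (fun p => p.1 k) (he (c • 1) g)
    rw [fiberConeMap_smul, map_one, smul_mul_fiberCone, one_mul] at h1
    refine h1.trans ?_
    change c • (1 : NoetherNormalization x) * (e g).1 k = _
    rw [smul_mul_fiberCone, one_mul]
  let φ : FiberPiece (maximalIdeal A) d →ₗ[A]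
      ((k : {k : FreeIndex (reductionNumber x) α // (k.1 : ℕ) ≤ d}) →
        FiberPiece (Ideal.span {x}) (d - k.1.1)) :=
    { toFun := fun z k => (e (DirectSum.of _ d z)).1 k.1 (d - k.1.1)
      map_add' := fun z w => funext fun k => by rw [map_add, map_add]; rfl
      map_smul' := fun c z => funext fun k => by
        have : (DirectSum.of _ d (c • z) : TangentCone A) = c • DirectSum.of _ d z :=
          map_smul (DirectSum.lof A ℕ _ d) c z
        rw [this, hsmul]
        rfl }
  have hφ : ∀ z k, φ z k = (e (DirectSum.of _ d z)).1 k.1 (d - k.1.1) := fun _ _ => rfl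
  have hφinj : Function.Injective φ := by
    rw [injective_iff_map_eq_zero]
    intro z hz
    have hg : e (DirectSum.of _ d z) = 0 := by
      refine Prod.ext (funext fun k => ?_) (funext fun k => hempty.elim k)
      have hk := ((hdeg d (DirectSum.of _ d z)).1 ⟨z, rfl⟩).1 k
      unfold shiftedDegreePart at hk
      split_ifs at hk with h
      · rw [← mem_degreePart_iff.1 hk, ← hφ z ⟨k, h⟩, hz]
        exact map_zero _
      · exact hk
    rw [map_eq_zero_iff _ e.injective] at hg
    exact DirectSum.of_injective d (hg.trans (map_zero _).symm)
  have hφsurj : Function.Surjective φ := by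
    intro y
    let f : FreeIndex (reductionNumber x) α → NoetherNormalization x := fun k =>
      if h : (k.1 : ℕ) ≤ d then DirectSum.of _ (d - k.1) (y ⟨k, h⟩) else 0
    obtain ⟨g, hg⟩ := e.surjective (f, fun k => hempty.elim k)
    have hgd : g ∈ degreePart (maximalIdeal A) d := by
      rw [hdeg, hg]
      refine ⟨fun k => ?_, fun k => hempty.elim k⟩
      unfold shiftedDegreePart
      dsimp only [f]
      split_ifs with h
      · exact ⟨_, rfl⟩
      · exact zero_mem _
    obtain ⟨z, rfl⟩ := hgd
    refine ⟨z, funext fun k => ?_⟩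
    rw [hφ, hg]
    dsimp only [f]
    rw [dif_pos k.2, DirectSum.of_eq_same]
  have hlen := (LinearEquiv.ofBijective φ ⟨hφinj, hφsurj⟩).length_eq
  rw [length_fiberPiece, Module.length_pi_of_fintype] at hlen
  simp only [length_fiberPiece_span_singleton hx0, Finset.sum_const, Finset.card_univ,
    nsmul_eq_mul, mul_one] at hlen
  exact_mod_cast hlen

theorem card_freeIndex_le {r : ℕ} (α : ℕ → ℕ) {d : ℕ} (hd : d ≤ r) :
    Fintype.card {k : FreeIndex r α // (k.1 : ℕ) ≤ d} = ∑ i ∈ Finset.range (d + 1), α i := by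
  rw [Fintype.card_subtype, Finset.card_filter, Fintype.sum_sigma]
  have h : ∀ i : ↥(Finset.Icc 0 r), (∑ _l : Fin (α i), if (i : ℕ) ≤ d then 1 else 0) =
      if (i : ℕ) ≤ d then α i else 0 := fun i => by split_ifs <;> simp
  rw [Finset.sum_congr rfl fun i _ => h i,
    Finset.sum_coe_sort (Finset.Icc 0 r) fun i => if i ≤ d then α i else 0, ← Finset.sum_filter]
  refine Finset.sum_congr ?_ fun _ _ => rfl
  ext i
  simp only [Finset.mem_filter, Finset.mem_Icc, Finset.mem_range]
  omega

/-- Equality would make the Apery invariant vanish; then Nakayama gives `𝔪^(i+1) = x𝔪^i`, against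
the minimality of the reduction number. -/
theorem mu_lt_mu_succ [IsNoetherianRing A]
    (hx : IsReduction (Ideal.span {x}) (maximalIdeal A))
    (hreg : ∀ (n : ℕ) (a : A), a ∈ maximalIdeal A ^ n → x * a ∈ maximalIdeal A ^ (n + 2) →
      a ∈ maximalIdeal A ^ (n + 1)) {i : ℕ} (hi : i < reductionNumber x) :
    mu A i < mu A (i + 1) := by
  have hxm : x ∈ maximalIdeal A := hx.1 (Ideal.mem_span_singleton_self x)
  have h := aperyInvariant_add_mu hxm hreg i
  have hne : aperyInvariant x (i + 1) ≠ 0 := by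
    intro h0
    rw [aperyInvariant, quotLength, Module.length_eq_zero_iff,
      Submodule.Quotient.subsingleton_iff, Submodule.submoduleOf,
      Submodule.comap_subtype_eq_top] at h0
    have hle : maximalIdeal A ^ (i + 1) ≤
        Ideal.span {x} * maximalIdeal A ^ i ⊔ maximalIdeal A • maximalIdeal A ^ (i + 1) := by
      intro a ha
      obtain ⟨c, hc, y, hy, rfl⟩ := Submodule.mem_sup.1 (h0 (Submodule.mem_sup_left ha))
      obtain ⟨b, rfl⟩ := Ideal.mem_span_singleton.1 hy
      refine Submodule.mem_sup.2 ⟨x * b, Ideal.mul_mem_mul (Ideal.mem_span_singleton_self x)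
        (mem_pow_of_pow_mul_mem hreg 1 i ?_), c, by rwa [smul_eq_mul, ← pow_succ'], add_comm _ _⟩
      rw [pow_one, ← add_sub_cancel_left c (x * b)]
      exact sub_mem ha (Ideal.pow_le_pow_right (Nat.le_succ _) hc)
    have hle' := Submodule.le_of_le_smul_of_le_jacobson_bot
      (IsNoetherian.noetherian (maximalIdeal A ^ (i + 1))) (maximalIdeal_le_jacobson _) hle
    refine (Nat.sInf_le (m := i) ?_).not_gt hi
    refine le_antisymm hle' ?_
    rw [pow_succ']
    exact Ideal.mul_mono_left hx.1
  generalize aperyInvariant x (i + 1) = a at h hne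
  cases a with
  | top => simp at h
  | coe n =>
    norm_cast at h hne
    omega

end Uniqueness

end MicroInvariants

end

/-! ### Assembly of the equalities. -/

open MicroInvariants
theorem mainTheorem3 {A : Type*} [CommRing A] [IsLocalRing A]
    (hA : IsCohenMacaulayLocalRing A) (hdim : ringKrullDim A = 1)
    [Infinite (IsLocalRing.ResidueField A)]
    (hG : IsCohenMacaulayRing (TangentCone A))
    (x : A) (hx : IsMinimalReduction (Ideal.span {x}) (IsLocalRing.maximalIdeal A)) :
    (∃ (α : ℕ → ℕ) (τ : ℕ → ℕ → ℕ), IsTangentConeInvariants x hx.le α τ) ∧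
    ∀ (α : ℕ → ℕ) (τ : ℕ → ℕ → ℕ), IsTangentConeInvariants x hx.le α τ →
      ∀ i : ℕ, 1 ≤ i → i ≤ reductionNumber x →
        0 < α i ∧
        (layerLength A (i - 1) ≠ ⊤ ∧ layerLength A i ≠ ⊤ ∧
          (α i : ℤ) = microInvariant A i) ∧
        (α i : ℕ∞) = aperyInvariant x i ∧
        (α i : ℤ) = (mu A i : ℤ) - (mu A (i - 1) : ℤ) := by
  have := hA.isNoetherianRing
  have hred : IsReduction (Ideal.span {x}) (IsLocalRing.maximalIdeal A) := hx.prop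
  have hdim' : ¬ Ring.KrullDimLE 0 A := fun h => by
    have := Ring.krullDimLE_iff.1 h
    rw [hdim] at this
    exact absurd this (by norm_num)
  have hxm : x ∈ IsLocalRing.maximalIdeal A := hx.le (Ideal.mem_span_singleton_self x)
  have hreg := fun n a => mem_pow_succ_of_reduction_mul_mem (n := n) (a := a) hG hred hdim'
  refine ⟨exists_isTangentConeInvariants hred hreg, fun α τ h i hi hir => ?_⟩
  obtain ⟨i, rfl⟩ := Nat.exists_eq_add_of_le' hi
  -- The partial sums `α_0 + ... + α_d` for `d = i` and `d = i + 1` differ by one term.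
  have hmu : mu A (i + 1) = mu A i + α (i + 1) := by
    have hcard := fun d => mu_eq_card (mem_nonZeroDivisors_of_regular hreg)
      (shift_injective (hx := hxm) hreg) h d
    rw [hcard, hcard, card_freeIndex_le α hir, card_freeIndex_le α (by omega),
      Finset.sum_range_succ _ (i + 1)]
  have hlt := mu_lt_mu_succ hred hreg hir
  -- A finite sum makes each length finite, so the `toNat` in `microInvariant` loses nothing.
  have hfinite : ∀ {a : ℕ∞} {b c : ℕ}, a + b = c → ∃ n : ℕ, a = n ∧ n + b = c := by
    intro a b c habc
    cases a with
    | top => simp at habc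
    | coe n => exact ⟨n, rfl, by exact_mod_cast habc⟩
  obtain ⟨l, hl, hl'⟩ := hfinite
    (layerLength_add_mu hxm (reductionNumber_spec hred) hreg (i := i) (by omega))
  obtain ⟨l₁, hl₁, hl₁'⟩ := hfinite
    (layerLength_add_mu hxm (reductionNumber_spec hred) hreg hir)
  obtain ⟨g, hg, hg'⟩ := hfinite (aperyInvariant_add_mu hxm hreg i)
  rw [Nat.add_sub_cancel]
  refine ⟨by omega, ⟨?_, ?_, ?_⟩, ?_, by omega⟩
  · rw [hl]; exact ENat.natCast_ne_top _
  · rw [hl₁]; exact ENat.natCast_ne_top _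
  · rw [microInvariant, Nat.add_sub_cancel, hl, hl₁, ENat.toNat_natCast, ENat.toNat_natCast]
    omega
  · rw [hg, show g = α (i + 1) by omega]
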